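/- Let $d\ge 1$, write $\mathbf 1_{k}=(1,\dots,1)\in\mathbb R^k$, and for $s,t\in\mathbb R_+^d$ write $s\le t$ (resp. $s<t$) if $s_i\le t_i$ (resp. $s_i<t_i$) for all $i$. For $a\le b$ in $\mathbb R_+^d$ let $]a,b]=\{t\in\mathbb R_+^d: a<t\le b\}$ and $\Delta_a^bX=\sum_{\varepsilon\in\{0,1\}^d}(-1)^{|\varepsilon|}X_{c_\varepsilon(a,b)}$, where $|\varepsilon|=\sum_i\varepsilon_i$ and $c_\varepsilon(a,b)_i$ is $a_i$ if $\varepsilon_i=1$ and $b_i$ if $\varepsilon_i=0$. A $d$-parameter Lévy field is a family $X=(X_t)_{t\in\mathbb R_+^d}$ of real random variables on a probability space $(\Omega,\mathcal F,\mathbb P)$ such that: (i) almost surely, the path $t\mapsto X_t$ is lamp, that is: for each of the $2^d$ choices $\mathcal R=(\mathcal R_1,\dots,\mathcal R_d)$ with $\mathcal R_i\in\{\le,>\}$ and each $t$, the finite limit of $X_u$ as $u\to t$ with $t_i\,\mathcal R_i\,u_i$ for all $i$ exists (no condition if there is no such $u$ near $t$); this limit equals $X_t$ when $\mathcal R=(\le,\dots,\le)$;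 and $X_t=0$ whenever some $t_i=0$; (ii) $X$ is continuous in probability; (iii) the increments of $X$ over any finite sequence of disjoint boxes are independent; (iv) $\Delta_a^bX$ and $\Delta_{a+s}^{b+s}X$ have the same law whenever $s\in\mathbb R^d$, $a\le b$ in $\mathbb R_+^d$ and $a+s,b+s\in\mathbb R_+^d$. It has characteristic triplet $(\gamma,\sigma,\mu)$ if $\gamma,\sigma\in\mathbb R$, $\mu$ is a Lévy measure ($\mu(\{0\})=0$ and $\int(1\wedge x^2)\,\mu(dx)<\infty$), and for all $t\in\mathbb R_+^d$ and $u\in\mathbb R$, $$\mathbb E\,e^{iuX_t}=\exp\Big[t_1\cdots t_d\Big(iu\gamma-\tfrac12\sigma^2u^2+\int_{\mathbb R}\big(e^{iux}-1-iux\mathbf 1_{|x|\le1}\big)\,\mu(dx)\Big)\Big].$$ For $p\in\mathbb N$ and $\varphi$ in the space $\mathcal D(\mathbb R^d)$ of smooth compactly supported functions $\mathbb R^d\to\mathbb R$, let $\mathcal N_p(\varphi)=\sum_{|\alpha|,|\beta|\le p}\sup_{t\in\mathbb R^d}|t^\alpha\varphi^{(\beta)}(t)|$ (sum over multi-indices $\alpha,\beta\in\mathbb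 N^d$), and let $\langle X,\varphi\rangle=\int_{\mathbb R_+^d}X_t\,\varphi(t)\,dt$. **Lemma.** Let $\nu$ be a measure on $\mathbb R$ with $0<\lambda:=\nu(\{|x|\ge1\})<\infty$, and let $X^P$ be a compound Poisson sheet with jump intensity $\mathbf 1_{|x|\ge1}\nu$, that is, a $d$-parameter Lévy field with characteristic triplet $\big(\int_{|x|=1}x\,\nu(dx),\,0,\,\mathbf 1_{|x|\ge1}\nu\big)$; equivalently, with $\mathbb E\,e^{iuX^P_t}=\exp\big[t_1\cdots t_d\int_{|x|\ge1}(e^{iux}-1)\,\nu(dx)\big]$. Let $L_t=X^P_{(\mathbf 1_{d-1},t)}$ for $t\ge0$, and let $(S_n)_{n\ge1}$ be its successive jump times: $S_0=0$, and $S_{n+1}\in[0,\infty]$ is the infimum of the times $t>S_n$ at which $L$ is not left-continuous (with $\inf\emptyset=\infty$). Then there exist functions $\varphi_n=\varphi_n^\omega\in\mathcal D(\mathbb R^d)$, for $\omega\in\Omega$ and $n\ge1$, such that: 1. for every $p\in\mathbb N$ there is a finite non-random constant $C_p$ with $$\mathcal N_p(\varphi_n)\le C_p\,S_n^{3d+4p}\qquad\text{for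 all }\omega\in\Omega,\ n\ge1\text{ with }S_n(\omega)\ge1;$$ 2. there is an event $\Omega'$ with $\mathbb P(\Omega')=1$ such that for every $\omega\in\Omega'$ there is an integer $N(\omega)$ such that, for all $n\ge N(\omega)$: $S_n(\omega)<\infty$, the support of $\varphi_n$ is contained in $\mathbb R_+^d$, $X^P(\omega)$ is constant on the support of $\varphi_n$, and $\langle X^P,\varphi_n\rangle(\omega)=L_{S_n}(\omega)$. -/

import Mathlib

open MeasureTheory ProbabilityTheory Filter Topology
open scoped NNReal ENNReal

noncomputable section

namespace LevyField

/-- The box `]a,b] = {t ∈ ℝ₊ᵈ : a < t ≤ b}`, where `a < t` means `a i < t i` for every `i`. -/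
def box {d : ℕ} (a b : Fin d → ℝ≥0) : Set (Fin d → ℝ≥0) :=
  {t | ∀ i, a i < t i ∧ t i ≤ b i}

/-- The increment `Δ_a^b x = ∑_{ε ∈ {0,1}ᵈ} (-1)^{|ε|} x(c_ε(a,b))` over the box `]a,b]`.
A vector `ε ∈ {0,1}ᵈ` is encoded as the set of the indices `i` with `ε i = 1`; the point
`c_ε(a,b)` has coordinate `a i` at these indices and `b i` at the other ones. -/
def increment {d : ℕ} (x : (Fin d → ℝ≥0) → ℝ) (a b : Fin d → ℝ≥0) : ℝ :=
  ∑ ε : Finset (Fin d), (-1 : ℝ) ^ ε.card * x (fun i => if i ∈ ε then a i else b i)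

/-- The set of `u ∈ ℝ₊ᵈ` with `t ℛ u`, where `ℛ i` is `≤` if `ρ i` is true and `>` otherwise. -/
def related {d : ℕ} (ρ : Fin d → Bool) (t : Fin d → ℝ≥0) : Set (Fin d → ℝ≥0) :=
  {u | ∀ i, if ρ i = true then t i ≤ u i else t i > u i}

/-- The function `x : ℝ₊ᵈ → ℝ` is lamp (has limits along monotone paths): a finite limit exists
at every point for each of the `2ᵈ` relations `ℛ`, the limit for `ℛ = (≤,…,≤)` is the value, and
the function vanishes at the points that have a coordinate equal to zero. -/
structure IsLamp {d : ℕ} (x : (Fin d → ℝ≥0) → ℝ) : Prop where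
  exists_limit : ∀ (ρ : Fin d → Bool) (t : Fin d → ℝ≥0),
    ∃ l : ℝ, Tendsto x (𝓝[related ρ t] t) (𝓝 l)
  right_continuous : ∀ t : Fin d → ℝ≥0,
    Tendsto x (𝓝[related (fun _ => true) t] t) (𝓝 (x t))
  zero_on_axes : ∀ t : Fin d → ℝ≥0, (∃ i, t i = 0) → x t = 0

/-- `d`-parameter Lévy fields `X = (X_t)_{t ∈ ℝ₊ᵈ}` on a probability space. -/
structure IsLevyField {d : ℕ} {Ω : Type*} [MeasurableSpace Ω] (P : Measure Ω)
    (X : (Fin d → ℝ≥0) → Ω → ℝ) : Prop where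
  measurable : ∀ t, Measurable (X t)
  lamp : ∀ᵐ ω ∂P, IsLamp (fun t => X t ω)
  continuous_in_probability : ∀ t, TendstoInMeasure P X (𝓝 t) (X t)
  indep_increments : ∀ (n : ℕ) (a b : Fin n → Fin d → ℝ≥0), (∀ k, a k ≤ b k) →
    (∀ j k, j ≠ k → Disjoint (box (a j) (b j)) (box (a k) (b k))) →
    iIndepFun (fun k ω => increment (fun t => X t ω) (a k) (b k)) P
  stationary_increments : ∀ (a b a' b' : Fin d → ℝ≥0) (s : Fin d → ℝ), a ≤ b → a' ≤ b' →
    (∀ i, (a' i : ℝ) = a i + s i) → (∀ i, (b' i : ℝ) = b i + s i) →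
    IdentDistrib (fun ω => increment (fun t => X t ω) a b)
      (fun ω => increment (fun t => X t ω) a' b') P P

/-- Lévy measures on `ℝ \ {0}`, as measures on `ℝ` without mass at `0`. -/
structure IsLevyMeasure (ν : Measure ℝ) : Prop where
  zero : ν {0} = 0
  finite : ∫⁻ x, ENNReal.ofReal (min 1 (x ^ 2)) ∂ν < ∞

/-- The Lévy-Khintchine exponent of the triplet `(γ, σ, ν)`, for the truncation function
`𝟙_{|x| ≤ 1}`. -/
def levyExponent (γ σ : ℝ) (ν : Measure ℝ) (u : ℝ) : ℂ :=
  Complex.I * u * γ - (1 / 2 : ℂ) * σ ^ 2 * u ^ 2 +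
    ∫ x : ℝ, (Complex.exp (Complex.I * u * x) - 1 -
      Complex.I * u * x * Set.indicator {y : ℝ | |y| ≤ 1} (fun _ => (1 : ℂ)) x) ∂ν

/-- `X` has the characteristic triplet `(γ, σ, ν)`: `ν` is a Lévy measure, and for each
`t ∈ ℝ₊ᵈ` the characteristic function of `X_t` is the one of the triplet
`Leb([0,t]) (γ, σ, ν)`, where `Leb([0,t]) = ∏ i, t i`. -/
def HasCharacteristicTriplet {d : ℕ} {Ω : Type*} [MeasurableSpace Ω] (P : Measure Ω)
    (X : (Fin d → ℝ≥0) → Ω → ℝ) (γ σ : ℝ) (ν : Measure ℝ) : Prop :=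
  IsLevyMeasure ν ∧ ∀ (t : Fin d → ℝ≥0) (u : ℝ),
    ∫ ω, Complex.exp (Complex.I * u * X t ω) ∂P =
      Complex.exp (((∏ i, (t i : ℝ) : ℝ) : ℂ) * levyExponent γ σ ν u)

/-- The point `(1,…,1,t)` of `ℝ₊ᵈ`, `d = m + 1`. -/
def linePoint (m : ℕ) (t : ℝ≥0) : Fin (m + 1) → ℝ≥0 :=
  Function.update (fun _ => 1) (Fin.last m) t

/-- `t` is a jump time of the path `l : ℝ₊ → ℝ`: the path is not left-continuous at `t`.
(The time `0` is never a jump time. For a càdlàg path these are the times `t > 0` with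
`l (t-) ≠ l t`.) -/
def IsJumpTime (l : ℝ≥0 → ℝ) (t : ℝ≥0) : Prop :=
  ¬ ContinuousWithinAt l (Set.Iio t) t

/-- The successive jump times of a path: `S 0 = 0`, and `S (n+1)` is the infimum of the jump times
after `S n`, which is `∞` when there is none. -/
def jumpTime (l : ℝ≥0 → ℝ) : ℕ → ℝ≥0∞
  | 0 => 0
  | n + 1 => sInf ((fun s : ℝ≥0 => (s : ℝ≥0∞)) '' {s | IsJumpTime l s ∧ jumpTime l n < s})

/-- Test functions: the space `𝒟(ℝᵈ)` of smooth functions with compact support. -/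
def IsTestFunction {d : ℕ} (φ : (Fin d → ℝ) → ℝ) : Prop :=
  ContDiff ℝ (⊤ : ℕ∞) φ ∧ HasCompactSupport φ

/-- The partial derivative with respect to the coordinate `i`. -/
def partialDeriv {d : ℕ} (i : Fin d) (φ : (Fin d → ℝ) → ℝ) : (Fin d → ℝ) → ℝ :=
  fun t => fderiv ℝ φ t (Pi.single i 1)

/-- The partial derivative `φ^(β)` of multi-index `β`. -/
def multiDeriv {d : ℕ} (β : Fin d → ℕ) (φ : (Fin d → ℝ) → ℝ) : (Fin d → ℝ) → ℝ :=
  (List.finRange d).foldr (fun i g => (partialDeriv i)^[β i] g) φ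

/-- The multi-indices `α ∈ ℕᵈ` with `|α| = ∑ i, α i ≤ p`. -/
def multiIndices (d p : ℕ) : Finset (Fin d → ℕ) :=
  (Fintype.piFinset fun _ => Finset.range (p + 1)).filter fun α => ∑ i, α i ≤ p

/-- The norm `𝒩_p(φ) = ∑_{|α|,|β| ≤ p} sup_t |t^α φ^(β)(t)|`, with values in `[0,∞]`. -/
def schwartzNorm {d : ℕ} (p : ℕ) (φ : (Fin d → ℝ) → ℝ) : ℝ≥0∞ :=
  ∑ α ∈ multiIndices d p, ∑ β ∈ multiIndices d p,
    ⨆ t : Fin d → ℝ, ENNReal.ofReal |(∏ i, t i ^ α i) * multiDeriv β φ t|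

/-- The pairing `⟨x, φ⟩ = ∫_{ℝ₊ᵈ} x(t) φ(t) dt`. -/
def pairing {d : ℕ} (x : (Fin d → ℝ≥0) → ℝ) (φ : (Fin d → ℝ) → ℝ) : ℝ :=
  ∫ t in {t : Fin d → ℝ | ∀ i, 0 ≤ t i}, x (fun i => (t i).toNNReal) * φ t

end LevyField

end

/-!
The test functions are bumps of integral one on the boxes of side `S_n⁻³` with lower corner
`(1, …, 1, S_n)`. The negative power of `S_n` in the side gives the bound on the norms
(`exists_schwartzNorm_boxBump_le`), and the pairing is `L_{S_n}` as soon as the sheet is constant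
on the box. This is proved for all large `n` by the first Borel-Cantelli lemma, applied to
deterministic slabs and time intervals, so that the random times `S_n` need no strong Markov
property.

The probabilistic input is that an increment over a box of volume `v` is nonzero with probability
at most `K v` (`exists_hasIncrementBound`), because its characteristic function is within `O(v)` of
`1` uniformly. Together with right-continuity it shows that the sheet does not depend on the
coordinate `j` in a slab of volume `v`, off an event of probability at most `K v`
(`measure_exists_ne_update_le`). For jump times in `(k + 1, k + 2]` and boxes of side `(k + 1)⁻³`
the slabs in the directions other than the last have volume `O(k⁻²)`; off their exceptional events
the sheet coincides on the box with the line `t ↦ X (1, …, 1, t)` (`eq_linePoint_of_notMem_badSet`).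

It remains to see that the line is constant for a time `(k + 1)⁻³` after each of its jumps in
`(k + 1, k + 2]`. By independence, two increments on a grid of mesh `1 / n` that are at distance at
most `δ` are both nonzero with probability `O(δ)`, uniformly in `n`
(`measure_eventually_not_sparseOnGrid_le`). If there is no such pair for infinitely many `n`, the
path is constant for a time `δ` after each jump (`IsCadlag.eq_of_isJumpTime`), and it is constant on
intervals without jumps (`IsCadlag.eq_of_not_isJumpTime`). With `δ` tending to `0`, the same
estimate shows that the jump times are locally finite and, since the line keeps moving
(`ae_frequently_line_ne`), that they are unbounded. Hence the `S_n` are finite jump times that tend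
to infinity (`exists_jumpTime_eq`).
-/

open MeasureTheory ProbabilityTheory Filter Topology
open scoped NNReal ENNReal

namespace LevyField

/-! ### Vanishing of the increments -/

/-- Fatou's lemma for sets; none of the sets needs to be measurable. -/
theorem measure_setOf_eventually_mem_le {α : Type*} [MeasurableSpace α] (μ : Measure α)
    (s : ℕ → Set α) (c : ℝ≥0∞) (h : ∀ᶠ n in atTop, μ (s n) ≤ c) :
    μ {x | ∀ᶠ n in atTop, x ∈ s n} ≤ c := by
  have h1 : {x | ∀ᶠ n in atTop, x ∈ s n} = ⋃ N, {x | ∀ n ≥ N, x ∈ s n} := by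
    ext x
    simp [eventually_atTop]
  have hm : Monotone fun N => {x | ∀ n ≥ N, x ∈ s n} := by
    intro N M hNM x (hx : ∀ n ≥ N, x ∈ s n) n hn
    exact hx n (le_trans hNM hn)
  rw [h1]
  refine le_of_tendsto (tendsto_measure_iUnion_atTop hm) ?_
  filter_upwards [h] with n hn
  exact (measure_mono fun x (hx : ∀ k ≥ n, x ∈ s k) => hx n le_rfl).trans hn

/-- A characteristic function that is uniformly close to `1` comes from a law with a large atom
at `0`: the standard estimate of `μ {|x| > r}` by the characteristic function on `[-2/r, 2/r]` does
not depend on `r` here, and `r` may tend to `0`. -/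
theorem measureReal_ne_zero_le_of_charFun (μ : Measure ℝ) [IsProbabilityMeasure μ] (c : ℝ)
    (h : ∀ u, ‖1 - charFun μ u‖ ≤ c) : μ.real {x | x ≠ 0} ≤ 2 * c := by
  have hr : ∀ r : ℝ, 0 < r → μ.real {x | r < |x|} ≤ 2 * c := by
    intro r hr
    refine (measureReal_abs_gt_le_integral_charFun hr).trans ?_
    have h2 := intervalIntegral.norm_integral_le_of_norm_le_const
      (a := -2 * r⁻¹) (b := 2 * r⁻¹) (f := fun t => 1 - charFun μ t) (C := c) (fun x _ => h x)
    have h3 : |2 * r⁻¹ - -2 * r⁻¹| = 4 * r⁻¹ := by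
      rw [abs_of_nonneg] <;> ring_nf; positivity
    rw [h3] at h2
    calc 2⁻¹ * r * ‖∫ t in (-2 * r⁻¹)..(2 * r⁻¹), 1 - charFun μ t‖
        ≤ 2⁻¹ * r * (c * (4 * r⁻¹)) := by gcongr
      _ = 2 * c := by field_simp; ring
  have h1 : {x : ℝ | x ≠ 0} = ⋃ n : ℕ, {x : ℝ | 1 / ((n : ℝ) + 1) < |x|} := by
    ext x
    simp only [Set.mem_ofPred_eq, Set.mem_iUnion]
    constructor
    · intro hx
      exact exists_nat_one_div_lt (abs_pos.2 hx)
    · rintro ⟨n, hn⟩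
      exact abs_pos.1 (lt_trans (by positivity) hn)
  have hm : Monotone fun n : ℕ => {x : ℝ | 1 / ((n : ℝ) + 1) < |x|} := by
    intro n k hnk x hx
    have hx' : 1 / ((n : ℝ) + 1) < |x| := hx
    have hnk' : (n : ℝ) ≤ k := by exact_mod_cast hnk
    exact lt_of_le_of_lt (one_div_le_one_div_of_le (by positivity) (by linarith)) hx'
  have ht := tendsto_measure_iUnion_atTop (μ := μ) hm
  rw [← h1] at ht
  have ht' := (ENNReal.tendsto_toReal (measure_ne_top μ _)).comp ht
  exact le_of_tendsto' ht' fun n => hr _ (by positivity)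

/-- For a function that vanishes on the axes, the difference in one coordinate is an increment
over a box. -/
theorem increment_single {d : ℕ} {x : (Fin d → ℝ≥0) → ℝ} (hx : IsLamp x) (j : Fin d)
    (c : ℝ≥0) (t : Fin d → ℝ≥0) :
    increment x (Pi.single j c) t = x t - x (Function.update t j c) := by
  unfold increment
  rw [← Finset.sum_subset (Finset.subset_univ {∅, {j}}), Finset.sum_pair (by simp)]
  · have h : (fun i => if i ∈ ({j} : Finset (Fin d)) then (Pi.single j c : Fin d → ℝ≥0) i
        else t i) = Function.update t j c := by
      ext i
      by_cases hi : i = j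
      · subst hi; simp
      · simp [hi]
    simp only [h]
    simp
    ring
  · intro ε _ hε
    simp only [Finset.mem_insert, Finset.mem_singleton, not_or] at hε
    obtain ⟨i, hi, hij⟩ : ∃ i ∈ ε, i ≠ j := by
      by_contra! hcon
      exact hε.2 (Finset.eq_singleton_iff_nonempty_unique_mem.2
        ⟨Finset.nonempty_iff_ne_empty.2 hε.1, hcon⟩)
    rw [hx.zero_on_axes _ ⟨i, by simp [hi, hij]⟩, mul_zero]

theorem increment_zero {d : ℕ} {x : (Fin d → ℝ≥0) → ℝ} (hx : IsLamp x) (b : Fin d → ℝ≥0) :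
    increment x 0 b = x b := by
  unfold increment
  rw [Finset.sum_eq_single ∅]
  · simp
  · intro ε _ hε
    obtain ⟨i, hi⟩ := Finset.nonempty_iff_ne_empty.2 hε
    rw [hx.zero_on_axes _ ⟨i, by simp [hi]⟩, mul_zero]
  · simp

/-- A function that does not depend on the coordinate `j` has zero increments: the corners that
differ in this coordinate cancel. -/
theorem sum_corner_update_eq_zero {d : ℕ} (x : (Fin d → ℝ≥0) → ℝ) (j : Fin d) (c : ℝ≥0)
    (a b : Fin d → ℝ≥0) :
    ∑ ε : Finset (Fin d), (-1 : ℝ) ^ ε.card *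
      x (Function.update (fun i => if i ∈ ε then a i else b i) j c) = 0 := by
  have hu : ∀ ε ε' : Finset (Fin d), (∀ i ≠ j, i ∈ ε ↔ i ∈ ε') →
      Function.update (fun i => if i ∈ ε then a i else b i) j c =
      Function.update (fun i => if i ∈ ε' then a i else b i) j c := by
    intro ε ε' h
    ext i
    by_cases hi : i = j
    · subst hi; simp
    · simp [hi, h i hi]
  refine Finset.sum_involution (fun ε _ => if j ∈ ε then ε.erase j else insert j ε) ?_ ?_ ?_ ?_
  · intro ε _
    by_cases hj : j ∈ ε
    · simp only [hj, if_true]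
      rw [hu ε (ε.erase j) (fun i hi => by simp [hi]), ← Finset.card_erase_add_one hj, pow_succ]
      ring
    · simp only [hj, if_false]
      rw [hu ε (insert j ε) (fun i hi => by simp [hi]), Finset.card_insert_of_notMem hj, pow_succ]
      ring
  · intro ε _ _
    by_cases hj : j ∈ ε
    · simp only [hj, if_true]
      exact fun h => absurd hj (by rw [← h]; simp)
    · simp only [hj, if_false]
      exact fun h => absurd (Finset.mem_insert_self j ε) (by rw [h]; exact hj)
  · simp
  · intro ε _
    by_cases hj : j ∈ ε
    · simp [hj, Finset.insert_erase]
    · simp [hj]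

/-- A function on a discrete grid that vanishes on the axes and has zero increments over the unit
cells is zero. The increment over the cell below `n` expresses the value at `n` by values at
smaller points. -/
theorem eq_zero_of_cells {d : ℕ} (g : (Fin d → ℕ) → ℝ) (N : ℕ)
    (h0 : ∀ n : Fin d → ℕ, (∃ i, n i = 0) → g n = 0)
    (hcell : ∀ n : Fin d → ℕ, (∀ i, n i < N) → ∑ ε : Finset (Fin d), (-1 : ℝ) ^ ε.card *
      g (fun i => if i ∈ ε then n i else n i + 1) = 0) :
    ∀ n : Fin d → ℕ, (∀ i, n i ≤ N) → g n = 0 := by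
  suffices H : ∀ (k : ℕ) (n : Fin d → ℕ), ∑ i, n i = k → (∀ i, n i ≤ N) → g n = 0 from
    fun n => H _ n rfl
  intro k
  induction k using Nat.strong_induction_on with
  | _ k ih =>
    intro n hk hn
    by_cases hz : ∃ i, n i = 0
    · exact h0 n hz
    push Not at hz
    have hc := hcell (fun i => n i - 1) (fun i => by have := hn i; have := hz i; omega)
    rw [Finset.sum_eq_single ∅] at hc
    · have hn1 : (fun i => n i - 1 + 1) = n := funext fun i => by have := hz i; omega
      simpa [hn1] using hc
    · intro ε _ hε
      obtain ⟨i, hi⟩ := Finset.nonempty_iff_ne_empty.2 hε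
      rw [ih _ _ _ rfl, mul_zero]
      · intro i
        have := hn i
        have := hz i
        split_ifs <;> omega
      · rw [← hk]
        refine Finset.sum_lt_sum (fun i _ => ?_) ⟨i, Finset.mem_univ _, ?_⟩
        · have := hz i
          split_ifs <;> omega
        · have := hz i
          simp only [hi, if_true]
          omega
    · simp

theorem norm_exp_sub_one_le_two (u x : ℝ) : ‖Complex.exp (Complex.I * u * x) - 1‖ ≤ 2 := by
  refine (norm_sub_le _ _).trans ?_
  rw [mul_assoc, mul_comm, ← Complex.ofReal_mul, Complex.norm_exp_ofReal_mul_I]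
  norm_num

theorem integrable_exp_sub_one (ν : Measure ℝ) (hfinite : ν {x | 1 ≤ |x|} < ∞) (u : ℝ) :
    Integrable (fun x : ℝ => Complex.exp (Complex.I * u * x) - 1)
      (ν.restrict {x : ℝ | 1 ≤ |x|}) :=
  have : IsFiniteMeasure (ν.restrict {x : ℝ | 1 ≤ |x|}) := ⟨by simpa using hfinite⟩
  Integrable.of_bound (C := 2) (by fun_prop) (ae_of_all _ fun x => norm_exp_sub_one_le_two u x)

/-- The exponent `∫_{|x| ≥ 1} (exp (iux) - 1) ν(dx)` of a compound Poisson law with jump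
measure `𝟙_{|x| ≥ 1} ν`. -/
noncomputable def poissonExponent (ν : Measure ℝ) (u : ℝ) : ℂ :=
  ∫ x in {x : ℝ | 1 ≤ |x|}, (Complex.exp (Complex.I * u * x) - 1) ∂ν

/-- The truncation function compensates the jumps of modulus exactly one, and the drift undoes
this. -/
theorem levyExponent_eq (ν : Measure ℝ) (hfinite : ν {x | 1 ≤ |x|} < ∞) (u : ℝ) :
    levyExponent (∫ x in {x : ℝ | |x| = 1}, x ∂ν) 0 (ν.restrict {x | 1 ≤ |x|}) u =
      poissonExponent ν u := by
  have hfin : IsFiniteMeasure (ν.restrict {x : ℝ | 1 ≤ |x|}) := ⟨by simpa using hfinite⟩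
  have hm1 : MeasurableSet {x : ℝ | 1 ≤ |x|} := measurableSet_le measurable_const (by fun_prop)
  have hm2 : MeasurableSet {x : ℝ | |x| = 1} := measurableSet_eq_fun (by fun_prop) (by fun_prop)
  have hi1 : Integrable (fun x : ℝ => Complex.exp (Complex.I * u * x) - 1)
      (ν.restrict {x : ℝ | 1 ≤ |x|}) :=
    integrable_exp_sub_one ν hfinite u
  have heq : ∀ᵐ x ∂(ν.restrict {x : ℝ | 1 ≤ |x|}),
      Complex.I * u * x * Set.indicator {y : ℝ | |y| ≤ 1} (fun _ => (1 : ℂ)) x =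
      Set.indicator {y : ℝ | |y| = 1} (fun x => Complex.I * u * (x : ℂ)) x := by
    refine (ae_restrict_mem hm1).mono fun x hx => ?_
    by_cases h : |x| = 1
    · rw [Set.indicator_of_mem (by exact h.le), Set.indicator_of_mem (by exact h), mul_one]
    · rw [Set.indicator_of_notMem, Set.indicator_of_notMem (by exact h), mul_zero]
      exact fun h' => h (le_antisymm h' hx)
  have hi2 : Integrable (Set.indicator {y : ℝ | |y| = 1} (fun x => Complex.I * u * (x : ℂ)))
      (ν.restrict {x : ℝ | 1 ≤ |x|}) := by
    refine Integrable.of_bound (C := |u|) (AEStronglyMeasurable.indicator (by fun_prop) hm2)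
      (ae_of_all _ fun x => ?_)
    by_cases h : |x| = 1
    · rw [Set.indicator_of_mem (by exact h)]
      simp [h]
    · rw [Set.indicator_of_notMem (by exact h)]
      simp
  have hsub : {x : ℝ | |x| = 1} ⊆ {x : ℝ | 1 ≤ |x|} := fun x hx => (show |x| = 1 from hx).ge
  unfold levyExponent poissonExponent
  rw [integral_congr_ae (g := fun x : ℝ => (Complex.exp (Complex.I * u * x) - 1) -
    Set.indicator {y : ℝ | |y| = 1} (fun x => Complex.I * u * (x : ℂ)) x)
    (heq.mono fun x hx => by simp only [hx]), integral_sub hi1 hi2, integral_indicator hm2,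
    Measure.restrict_restrict hm2, Set.inter_eq_left.2 hsub,
    integral_const_mul, integral_complex_ofReal]
  push_cast
  ring

theorem norm_poissonExponent_le (ν : Measure ℝ) (hfinite : ν {x | 1 ≤ |x|} < ∞) (u : ℝ) :
    ‖poissonExponent ν u‖ ≤ 2 * ν.real {x | 1 ≤ |x|} :=
  norm_setIntegral_le_of_norm_le_const hfinite fun x _ => norm_exp_sub_one_le_two u x

/-- The increment of `X` over a box is nonzero with probability at most `K` times the volume of
the box. -/
def HasIncrementBound {d : ℕ} {Ω : Type*} [MeasurableSpace Ω] (P : Measure Ω)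
    (X : (Fin d → ℝ≥0) → Ω → ℝ) (K : ℝ≥0) : Prop :=
  ∀ a b : Fin d → ℝ≥0, a ≤ b →
    P {ω | increment (fun t => X t ω) a b ≠ 0} ≤ ((K * ∏ i, (b i - a i) : ℝ≥0) : ℝ≥0∞)

/-- By stationarity, the increment has the law of `X_t` with `t = b - a`, whose characteristic
function is within `4 λ v` of `1` when the volume `v` is small, `λ` being the total jump
intensity; for large `v` the bound exceeds `1`. -/
theorem exists_hasIncrementBound {d : ℕ} {Ω : Type*} [MeasurableSpace Ω] {P : Measure Ω}
    [IsProbabilityMeasure P] {X : (Fin d → ℝ≥0) → Ω → ℝ} {ν : Measure ℝ}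
    (hfinite : ν {x | 1 ≤ |x|} < ∞) (hX : IsLevyField P X)
    (hchar : ∀ (t : Fin d → ℝ≥0) (u : ℝ), ∫ ω, Complex.exp (Complex.I * u * X t ω) ∂P =
      Complex.exp (((∏ i, (t i : ℝ) : ℝ) : ℂ) * poissonExponent ν u)) :
    ∃ K : ℝ≥0, HasIncrementBound P X K := by
  set l : ℝ := ν.real {x | 1 ≤ |x|} with hl
  have hl0 : 0 ≤ l := measureReal_nonneg
  refine ⟨(8 * l).toNNReal, fun a b hab => ?_⟩
  set t : Fin d → ℝ≥0 := fun i => b i - a i with ht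
  have hst := hX.stationary_increments 0 t a b (fun i => a i) (fun i => by simp)
    hab (fun i => by simp) (fun i => by simp [ht, NNReal.coe_sub (hab i)])
  have hms : MeasurableSet {x : ℝ | x ≠ 0} := (measurableSet_singleton 0).compl
  have h1 : P {ω | increment (fun t => X t ω) a b ≠ 0} = P {ω | X t ω ≠ 0} := by
    have h2 := hst.measure_mem_eq hms
    rw [Set.preimage_ofPred_eq, Set.preimage_ofPred_eq] at h2
    rw [← h2]
    refine measure_congr ?_
    filter_upwards [hX.lamp] with ω hω
    change (increment (fun t => X t ω) 0 t ≠ 0) = (X t ω ≠ 0)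
    rw [increment_zero hω]
  rw [h1]
  set v : ℝ := ∏ i, (t i : ℝ) with hv
  have hv0 : 0 ≤ v := by positivity
  have hbound : P.real {ω | X t ω ≠ 0} ≤ 8 * l * v := by
    by_cases hlv : 2 * l * v ≤ 1
    · have : IsProbabilityMeasure (P.map (X t)) :=
        Measure.isProbabilityMeasure_map (hX.measurable t).aemeasurable
      have h3 := measureReal_ne_zero_le_of_charFun (P.map (X t)) (2 * (2 * l * v)) (fun u => by
        have h4 : charFun (P.map (X t)) u = Complex.exp ((v : ℂ) * poissonExponent ν u) := by
          rw [← hchar t u, charFun_apply_real, integral_map (hX.measurable t).aemeasurable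
            (by fun_prop)]
          congr 1 with ω
          ring_nf
        have h5 : ‖(v : ℂ) * poissonExponent ν u‖ ≤ 2 * l * v := by
          rw [norm_mul, Complex.norm_real, Real.norm_of_nonneg hv0]
          nlinarith [norm_poissonExponent_le ν hfinite u]
        rw [h4, norm_sub_rev]
        exact (Complex.norm_exp_sub_one_le (h5.trans hlv)).trans (by linarith))
      rw [map_measureReal_apply (hX.measurable t) hms] at h3
      exact h3.trans (by linarith)
    · have : P.real {ω | X t ω ≠ 0} ≤ 1 := measureReal_le_one
      linarith
  rw [← ofReal_measureReal, ENNReal.ofReal_le_iff_le_toReal ENNReal.coe_ne_top]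
  refine hbound.trans (le_of_eq ?_)
  rw [ENNReal.coe_toReal, NNReal.coe_mul, NNReal.coe_prod, Real.coe_toNNReal _ (by positivity)]

/-- A variable with the compound Poisson characteristic function is not almost surely `0`:
otherwise `cos (u x) = 1` for `ν`-almost every `x` with `|x| ≥ 1`, for `u = 1 / (n + 1)` with all
`n`, and no `x ≠ 0` satisfies this. -/
theorem measure_eq_zero_lt_one {Ω : Type*} [MeasurableSpace Ω] {P : Measure Ω}
    [IsProbabilityMeasure P] {Y : Ω → ℝ} {ν : Measure ℝ} (hY : Measurable Y)
    (hfinite : ν {x | 1 ≤ |x|} < ∞) (hpos : 0 < ν {x | 1 ≤ |x|})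
    (hchar : ∀ u : ℝ, ∫ ω, Complex.exp (Complex.I * u * Y ω) ∂P =
      Complex.exp (poissonExponent ν u)) : P {ω | Y ω = 0} < 1 := by
  have hfin : IsFiniteMeasure (ν.restrict {x : ℝ | 1 ≤ |x|}) := ⟨by simpa using hfinite⟩
  have hm1 : MeasurableSet {x : ℝ | 1 ≤ |x|} := measurableSet_le measurable_const (by fun_prop)
  refine lt_of_le_of_ne prob_le_one fun h1 => ?_
  have hY0 : ∀ᵐ ω ∂P, Y ω = 0 := by
    have hm : MeasurableSet {ω | Y ω = 0} := measurableSet_eq_fun hY measurable_const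
    rw [← prob_compl_eq_zero_iff hm] at h1
    exact h1
  have hre : ∀ u : ℝ, ∫ x in {x : ℝ | 1 ≤ |x|}, (1 - Real.cos (u * x)) ∂ν = 0 := by
    intro u
    have h2 : Complex.exp (poissonExponent ν u) = 1 := by
      rw [← hchar u, integral_congr_ae (g := fun _ => (1 : ℂ))
        (hY0.mono fun ω hω => by simp [hω])]
      simp
    have h3 : (poissonExponent ν u).re = 0 := by
      have := congrArg norm h2
      rw [Complex.norm_exp, norm_one, Real.exp_eq_one_iff] at this
      exact this
    have hi1 : Integrable (fun x : ℝ => Complex.exp (Complex.I * u * x) - 1)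
        (ν.restrict {x : ℝ | 1 ≤ |x|}) :=
      integrable_exp_sub_one ν hfinite u
    have h4 := integral_re hi1
    unfold poissonExponent at h3
    rw [← neg_eq_zero, ← integral_neg]
    have h5 : ∀ x : ℝ, -(1 - Real.cos (u * x)) =
        RCLike.re (Complex.exp (Complex.I * u * x) - 1) := by
      intro x
      rw [mul_assoc, mul_comm Complex.I, ← Complex.ofReal_mul, RCLike.re_eq_complex_re,
        Complex.sub_re, Complex.exp_ofReal_mul_I_re]
      simp
    simp_rw [h5]
    rw [h4]
    exact h3
  have hae : ∀ᵐ x ∂(ν.restrict {x : ℝ | 1 ≤ |x|}),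
      ∀ n : ℕ, Real.cos ((1 / ((n : ℝ) + 1)) * x) = 1 := by
    rw [ae_all_iff]
    intro n
    have h6 := (integral_eq_zero_iff_of_nonneg (fun x => by
      simpa using Real.cos_le_one _) (Integrable.of_bound (C := 2) (by fun_prop)
        (ae_of_all _ fun x => ?_))).1 (hre (1 / ((n : ℝ) + 1)))
    · filter_upwards [h6] with x hx
      simp only [Pi.zero_apply] at hx
      linarith
    · rw [Real.norm_eq_abs, abs_le]
      constructor <;> linarith [Real.cos_le_one (1 / ((n : ℝ) + 1) * x),
        Real.neg_one_le_cos (1 / ((n : ℝ) + 1) * x)]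
  have hfalse : ∀ᵐ x ∂(ν.restrict {x : ℝ | 1 ≤ |x|}), False := by
    filter_upwards [hae, ae_restrict_mem hm1] with x hx hx1
    have hx1' : 1 ≤ |x| := hx1
    obtain ⟨n, hn⟩ := exists_nat_gt |x|
    have hb : |1 / ((n : ℝ) + 1) * x| < 2 * Real.pi := by
      rw [abs_mul, abs_of_pos (by positivity), one_div, inv_mul_lt_iff₀ (by positivity)]
      nlinarith [Real.pi_gt_three]
    have := (Real.cos_eq_one_iff_of_lt_of_lt (abs_lt.1 hb).1 (abs_lt.1 hb).2).1 (hx n)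
    have hx0 : x = 0 := by
      rcases mul_eq_zero.1 this with h | h
      · exact absurd h (by positivity)
      · exact h
    rw [hx0] at hx1'
    norm_num at hx1'
  have h7 : ν.restrict {x : ℝ | 1 ≤ |x|} = 0 := by
    rw [← ae_eq_bot]
    exact Filter.eventually_false_iff_eq_bot.1 hfalse
  rw [Measure.restrict_eq_zero] at h7
  exact hpos.ne' h7

/-! ### Slabs on which the field does not depend on a coordinate -/

/-- The point with index `n` of the grid that divides the box from `a` to `a + w` into `N` parts
in each direction. -/
noncomputable def gridPoint {d : ℕ} (a w : Fin d → ℝ≥0) (N : ℕ) (n : Fin d → ℕ) : Fin d → ℝ≥0 :=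
  fun i => a i + n i * (w i / N)

/-- If all the cells of the grid have zero increments, then on the grid `x` does not depend on the
coordinate `j`. The grid starts at `c` in the direction `j`, and on the axes in the others. -/
theorem eq_update_of_grid {d : ℕ} {x : (Fin d → ℝ≥0) → ℝ} (hx : IsLamp x) (j : Fin d)
    (c : ℝ≥0) (w : Fin d → ℝ≥0) (N : ℕ)
    (h : ∀ n : Fin d → ℕ, (∀ i, n i < N) → increment x (gridPoint (Pi.single j c) w N n)
      (gridPoint (Pi.single j c) w N (fun i => n i + 1)) = 0)
    (n : Fin d → ℕ) (hn : ∀ i, n i ≤ N) :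
    x (gridPoint (Pi.single j c) w N n) =
      x (Function.update (gridPoint (Pi.single j c) w N n) j c) := by
  rw [← sub_eq_zero]
  refine eq_zero_of_cells (fun n => x (gridPoint (Pi.single j c) w N n) -
      x (Function.update (gridPoint (Pi.single j c) w N n) j c)) N ?_ ?_ n hn
  · rintro n ⟨i, hi⟩
    by_cases hij : i = j
    · subst hij
      have : Function.update (gridPoint (Pi.single i c) w N n) i c =
          gridPoint (Pi.single i c) w N n := by
        rw [Function.update_eq_self_iff]
        simp [gridPoint, hi]
      simp [this]
    · have h1 : gridPoint (Pi.single j c) w N n i = 0 := by simp [gridPoint, hi, hij]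
      rw [hx.zero_on_axes _ ⟨i, h1⟩, hx.zero_on_axes _ ⟨i, by simp [hij, h1]⟩, sub_zero]
  · intro n hn
    have hg : ∀ ε : Finset (Fin d), gridPoint (Pi.single j c) w N
        (fun i => if i ∈ ε then n i else n i + 1) =
        fun i => if i ∈ ε then gridPoint (Pi.single j c) w N n i
          else gridPoint (Pi.single j c) w N (fun i => n i + 1) i := by
      intro ε
      ext i
      unfold gridPoint
      by_cases hi : i ∈ ε <;> simp [hi]
    simp only [hg, mul_sub, Finset.sum_sub_distrib]
    rw [sum_corner_update_eq_zero, sub_zero]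
    exact h n hn

theorem le_ceil_grid (a w t : ℝ≥0) (hw : 0 < w) (hat : a ≤ t) {N : ℕ} (hN : 0 < N) :
    t ≤ a + ⌈(t - a) / (w / N)⌉₊ * (w / N) := by
  have hN' : (0 : ℝ≥0) < w / N := by positivity
  have h2 : (t - a) / (w / N) ≤ ⌈(t - a) / (w / N)⌉₊ := Nat.le_ceil _
  rw [div_le_iff₀ hN'] at h2
  calc t = a + (t - a) := (add_tsub_cancel_of_le hat).symm
    _ ≤ _ := by gcongr

theorem tendsto_ceil_grid (a w t : ℝ≥0) (hw : 0 < w) (hat : a ≤ t) :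
    Tendsto (fun N : ℕ => a + ⌈(t - a) / (w / N)⌉₊ * (w / N)) atTop (𝓝 t) := by
  have h1 : Tendsto (fun N : ℕ => t + w / N) atTop (𝓝 (t + 0)) := by
    refine tendsto_const_nhds.add ?_
    exact _root_.tendsto_const_div_atTop_nhds_zero_nat w
  rw [add_zero] at h1
  refine tendsto_of_tendsto_of_tendsto_of_le_of_le' tendsto_const_nhds h1 ?_ ?_
  · filter_upwards [eventually_gt_atTop 0] with N hN
    exact le_ceil_grid a w t hw hat hN
  · filter_upwards [eventually_gt_atTop 0] with N hN
    have hN' : (0 : ℝ≥0) < w / N := by positivity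
    have h2 : (⌈(t - a) / (w / N)⌉₊ : ℝ≥0) ≤ (t - a) / (w / N) + 1 :=
      (Nat.ceil_lt_add_one zero_le).le
    calc a + ⌈(t - a) / (w / N)⌉₊ * (w / N) ≤ a + ((t - a) / (w / N) + 1) * (w / N) := by gcongr
      _ = a + (t - a) + w / N := by rw [add_mul, div_mul_cancel₀ _ hN'.ne', one_mul, add_assoc]
      _ = t + w / N := by rw [add_tsub_cancel_of_le hat]

theorem IsLamp.tendsto_of_ge {d : ℕ} {x : (Fin d → ℝ≥0) → ℝ} (hx : IsLamp x) {ι : Type*}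
    {l : Filter ι} {u : ι → Fin d → ℝ≥0} {t : Fin d → ℝ≥0} (hu : Tendsto u l (𝓝 t))
    (hge : ∀ᶠ n in l, t ≤ u n) : Tendsto (fun n => x (u n)) l (𝓝 (x t)) := by
  refine (hx.right_continuous t).comp (tendsto_nhdsWithin_iff.2 ⟨hu, ?_⟩)
  filter_upwards [hge] with n hn
  simpa [related] using fun i => hn i

/-- The probability that `X` depends on the coordinate `j ∈ [c, c + w j]` somewhere in the slab is
at most `K` times the volume of the slab. On each grid this is the union bound over the cells; if
the cells of infinitely many grids have zero increments, right-continuity gives the claim at all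
points. -/
theorem measure_exists_ne_update_le {d : ℕ} {Ω : Type*} [MeasurableSpace Ω] {P : Measure Ω}
    {X : (Fin d → ℝ≥0) → Ω → ℝ} (hlamp : ∀ᵐ ω ∂P, IsLamp (fun t => X t ω)) {K : ℝ≥0}
    (hK : HasIncrementBound P X K)
    (j : Fin d) (c : ℝ≥0) (w : Fin d → ℝ≥0) (hw : ∀ i, 0 < w i) :
    P {ω | ∃ t : Fin d → ℝ≥0, t ≤ Pi.single j c + w ∧ c ≤ t j ∧
      X t ω ≠ X (Function.update t j c) ω} ≤ ((K * ∏ i, w i : ℝ≥0) : ℝ≥0∞) := by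
  set a : Fin d → ℝ≥0 := Pi.single j c with ha
  set B : ℕ → Set Ω := fun N => {ω | ∃ n : Fin d → Fin N, increment (fun t => X t ω)
      (gridPoint a w N (fun i => n i)) (gridPoint a w N (fun i => (n i : ℕ) + 1)) ≠ 0} with hB
  have hPB : ∀ᶠ N in atTop, P (B N) ≤ ((K * ∏ i, w i : ℝ≥0) : ℝ≥0∞) := by
    filter_upwards [eventually_gt_atTop 0] with N hN
    have h1 : ∀ n : Fin d → Fin N, P {ω | increment (fun t => X t ω)
        (gridPoint a w N (fun i => n i)) (gridPoint a w N (fun i => (n i : ℕ) + 1)) ≠ 0} ≤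
        ((K * ∏ i, (w i / N) : ℝ≥0) : ℝ≥0∞) := by
      intro n
      refine (hK _ _ (fun i => ?_)).trans (le_of_eq ?_)
      · unfold gridPoint
        push_cast
        gcongr
        simp
      · congr 2
        refine Finset.prod_congr rfl fun i _ => ?_
        unfold gridPoint
        push_cast
        rw [add_mul, ← add_assoc, add_tsub_cancel_left, one_mul]
    have h2 : B N = ⋃ n : Fin d → Fin N, {ω | increment (fun t => X t ω)
        (gridPoint a w N (fun i => n i)) (gridPoint a w N (fun i => (n i : ℕ) + 1)) ≠ 0} := by
      ext ω
      simp [hB]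
    rw [h2]
    refine (measure_iUnion_fintype_le _ _).trans ((Finset.sum_le_sum fun n _ => h1 n).trans ?_)
    rw [Finset.sum_const, Finset.card_univ, Fintype.card_fun, Fintype.card_fin, Fintype.card_fin,
      Finset.prod_div_distrib, Finset.prod_const, Finset.card_univ, Fintype.card_fin]
    refine le_of_eq ?_
    rw [nsmul_eq_mul, ← ENNReal.coe_natCast, ← ENNReal.coe_mul]
    congr 1
    have : (N : ℝ≥0) ≠ 0 := by positivity
    push_cast
    field_simp
  refine le_trans (measure_mono_ae ?_) (measure_setOf_eventually_mem_le P B _ hPB)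
  filter_upwards [hlamp] with ω hω hmem
  obtain ⟨t, ht, hct, hne⟩ : ∃ t : Fin d → ℝ≥0, t ≤ a + w ∧ c ≤ t j ∧
      X t ω ≠ X (Function.update t j c) ω := hmem
  change ∀ᶠ N in atTop, ω ∈ B N
  by_contra hcon
  have hfr : ∃ᶠ N in atTop, ω ∉ B N := not_eventually.1 hcon
  have hat : a ≤ t := by
    intro i
    by_cases hi : i = j
    · subst hi; simpa [ha] using hct
    · simp [ha, hi]
  set u : ℕ → Fin d → ℝ≥0 := fun N => gridPoint a w N (fun i => ⌈(t i - a i) / (w i / N)⌉₊) with hu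
  have hut : Tendsto u atTop (𝓝 t) :=
    tendsto_pi_nhds.2 fun i => tendsto_ceil_grid (a i) (w i) (t i) (hw i) (hat i)
  have hge : ∀ᶠ N in atTop, t ≤ u N := by
    filter_upwards [eventually_gt_atTop 0] with N hN
    exact fun i => le_ceil_grid (a i) (w i) (t i) (hw i) (hat i) hN
  have h1 := hω.tendsto_of_ge hut hge
  have h2 := hω.tendsto_of_ge (u := fun N => Function.update (u N) j c)
    (t := Function.update t j c) (hut.update j tendsto_const_nhds)
    (by
      filter_upwards [hge] with N hN
      exact update_le_update_iff.2 ⟨le_rfl, fun i _ => hN i⟩)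
  have h3 := (h1.sub h2).eventually_ne (sub_ne_zero.2 hne)
  obtain ⟨N, hN, hN3, hN0⟩ := (hfr.and_eventually (h3.and (eventually_gt_atTop 0))).exists
  refine hN3 (sub_eq_zero.2 (eq_update_of_grid hω j c w N (fun n hn => ?_) _ fun i => ?_))
  · by_contra hne'
    exact hN ⟨fun i => ⟨n i, hn i⟩, hne'⟩
  · rw [Nat.ceil_le, div_le_iff₀ (by have := hw i; positivity)]
    have : (N : ℝ≥0) ≠ 0 := by positivity
    rw [mul_div_cancel₀ _ this, tsub_le_iff_left]
    exact ht i

/-! ### Paths with sparse increments on fine grids -/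

/-- On the grid of mesh `1 / n`, no two distinct increments of `l` are both nonzero when the first
of them is in `[k, k + 1]` and they are at distance about `δ` at most. The slack `1` in the
condition on `j` absorbs the rounding to grid points. -/
def SparseOnGrid (l : ℝ≥0 → ℝ) (k n : ℕ) (δ : ℝ≥0) : Prop :=
  ∀ i j : ℕ, k * n ≤ i → i < (k + 1) * n → i < j → (j : ℝ≥0) ≤ i + δ * n + 1 →
    l ((i + 1 : ℕ) / n) = l (i / n) ∨ l ((j + 1 : ℕ) / n) = l (j / n)

/-- Càdlàg functions on `[0, ∞)`: right-continuous, with finite left limits. -/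
structure IsCadlag (l : ℝ≥0 → ℝ) : Prop where
  right_continuous : ∀ t, ContinuousWithinAt l (Set.Ici t) t
  exists_left_limit : ∀ t, ∃ y, Tendsto l (𝓝[<] t) (𝓝 y)

theorem eq_of_forall_succ_eq {f : ℕ → ℝ} {A B : ℕ} (hAB : A ≤ B)
    (h : ∀ j, A ≤ j → j < B → f (j + 1) = f j) : f B = f A := by
  induction B, hAB using Nat.le_induction with
  | base => rfl
  | succ B hAB ih =>
    rw [h B hAB (Nat.lt_succ_self B), ih fun j h1 h2 => h j h1 (h2.trans (Nat.lt_succ_self B))]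

theorem tendsto_ceil_mul_div (u : ℝ≥0) :
    Tendsto (fun n : ℕ => (⌈u * n⌉₊ : ℝ≥0) / n) atTop (𝓝[≥] u) := by
  have h := tendsto_ceil_grid 0 1 u one_pos (zero_le)
  refine tendsto_nhdsWithin_iff.2 ⟨?_, ?_⟩
  · refine h.congr fun n => ?_
    simp [div_eq_mul_inv]
  · filter_upwards [eventually_gt_atTop 0] with n hn
    have hn' : (0 : ℝ≥0) < n := by positivity
    rw [Set.mem_Ici, le_div_iff₀ hn']
    exact Nat.le_ceil _

theorem tendsto_ceil_sub_one_div {s : ℝ≥0} (hs : 0 < s) :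
    Tendsto (fun n : ℕ => ((⌈s * n⌉₊ - 1 : ℕ) : ℝ≥0) / n) atTop (𝓝[<] s) := by
  refine tendsto_nhdsWithin_iff.2 ⟨?_, ?_⟩
  · have h1 := ((tendsto_ceil_mul_div s).mono_right nhdsWithin_le_nhds).sub
      (_root_.tendsto_const_div_atTop_nhds_zero_nat (1 : ℝ≥0))
    rw [tsub_zero] at h1
    refine h1.congr fun n => ?_
    rw [Nat.cast_tsub, Nat.cast_one, ← NNReal.sub_div]
  · filter_upwards [eventually_gt_atTop 0] with n hn
    have hn' : (0 : ℝ≥0) < n := by positivity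
    rw [Set.mem_Iio, div_lt_iff₀ hn', ← Nat.lt_ceil]
    have : 0 < ⌈s * n⌉₊ := Nat.ceil_pos.2 (by positivity)
    omega

theorem IsCadlag.tendsto_ceil {l : ℝ≥0 → ℝ} (hl : IsCadlag l) (u : ℝ≥0) :
    Tendsto (fun n : ℕ => l ((⌈u * n⌉₊ : ℝ≥0) / n)) atTop (𝓝 (l u)) :=
  (hl.right_continuous u).tendsto.comp (tendsto_ceil_mul_div u)

theorem isJumpTime_pos {l : ℝ≥0 → ℝ} {s : ℝ≥0} (hs : IsJumpTime l s) : 0 < s := by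
  rw [pos_iff_ne_zero]
  rintro rfl
  refine hs ?_
  have : Set.Iio (0 : ℝ≥0) = ∅ := by ext x; simp
  rw [this, ContinuousWithinAt, nhdsWithin_empty]
  exact tendsto_bot

/-- After a jump the path is constant for a time `δ`: on a fine grid the jump uses up the only
nonzero increment. -/
theorem IsCadlag.eq_of_isJumpTime {l : ℝ≥0 → ℝ} (hl : IsCadlag l) {k : ℕ} {δ : ℝ≥0}
    (h : ∃ᶠ n in atTop, SparseOnGrid l k n δ) {s u : ℝ≥0} (hs : IsJumpTime l s)
    (hks : k < s) (hsk : s ≤ k + 1) (hsu : s ≤ u) (hus : u ≤ s + δ) : l u = l s := by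
  by_contra hne
  have hs0 : 0 < s := isJumpTime_pos hs
  obtain ⟨y, hy⟩ := hl.exists_left_limit s
  have hys : y ≠ l s := by
    rintro rfl
    exact hs hy
  have h1 := ((hl.tendsto_ceil u).sub (hl.tendsto_ceil s)).eventually_ne (sub_ne_zero.2 hne)
  have h2 := ((hy.comp (tendsto_ceil_sub_one_div hs0)).sub (hl.tendsto_ceil s)).eventually_ne
    (sub_ne_zero.2 hys)
  obtain ⟨n, hn, hn1, hn2, hn0⟩ :=
    (h.and_eventually (h1.and (h2.and (eventually_gt_atTop 0)))).exists
  have hn' : (0 : ℝ≥0) < n := by positivity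
  have hA : k * n < ⌈s * n⌉₊ := by
    rw [Nat.lt_ceil]
    push_cast
    gcongr
  have hA' : ⌈s * n⌉₊ ≤ (k + 1) * n := by
    rw [Nat.ceil_le]
    push_cast
    gcongr
  refine hn1 (sub_eq_zero.2 (eq_of_forall_succ_eq (f := fun j : ℕ => l (j / n))
    (Nat.ceil_mono (by gcongr)) fun j hj1 hj2 => ?_))
  refine (hn (⌈s * n⌉₊ - 1) j (by omega) (by omega) (by omega) ?_).resolve_left ?_
  · calc (j : ℝ≥0) ≤ u * n := (Nat.lt_ceil.1 hj2).le
      _ ≤ (s + δ) * n := by gcongr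
      _ = s * n + δ * n := add_mul _ _ _
      _ ≤ ((⌈s * n⌉₊ - 1 + 1 : ℕ) : ℝ≥0) + δ * n := by
        gcongr
        rw [Nat.sub_add_cancel (by omega)]
        exact Nat.le_ceil _
      _ = _ := by push_cast; ring
  · intro h3
    rw [Nat.sub_add_cancel (by omega)] at h3
    exact hn2 (sub_eq_zero.2 h3.symm)

/-- Over an interval of length at most `δ`, the path on the grid changes by at most one of its
increments. -/
theorem SparseOnGrid.exists_step {l : ℝ≥0 → ℝ} {k n : ℕ} {δ : ℝ≥0} (h : SparseOnGrid l k n δ)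
    {A B : ℕ} (hAB : A < B) (hA : k * n ≤ A) (hB : B ≤ (k + 1) * n)
    (hδ : (B : ℝ≥0) ≤ A + δ * n + 1) :
    ∃ i, A ≤ i ∧ i < B ∧ l (i / n) = l (A / n) ∧ l ((i + 1 : ℕ) / n) = l (B / n) := by
  by_cases hall : ∀ j, A ≤ j → j < B → l ((j + 1 : ℕ) / n) = l (j / n)
  · have h1 := eq_of_forall_succ_eq (f := fun j : ℕ => l (j / n)) hAB.le hall
    exact ⟨A, le_rfl, hAB, rfl, (hall A le_rfl hAB).trans h1.symm⟩
  · push Not at hall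
    obtain ⟨i, hAi, hiB, hi⟩ := hall
    have hAi' : (A : ℝ≥0) ≤ i := by exact_mod_cast hAi
    refine ⟨i, hAi, hiB, eq_of_forall_succ_eq (f := fun j : ℕ => l (j / n)) hAi fun j h1 h2 => ?_,
      (eq_of_forall_succ_eq (f := fun j : ℕ => l (j / n)) (Nat.succ_le_of_lt hiB)
        fun j h1 h2 => ?_).symm⟩
    · refine (h j i (by omega) (by omega) h2 ?_).resolve_right hi
      have hAj' : (A : ℝ≥0) ≤ j := by exact_mod_cast h1
      have hiB' : (i : ℝ≥0) ≤ B := by exact_mod_cast hiB.le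
      exact hiB'.trans (hδ.trans (by gcongr))
    · refine (h i j (by omega) (by omega) h1 ?_).resolve_left hi
      have hjB' : (j : ℝ≥0) ≤ B := by exact_mod_cast h2.le
      exact hjB'.trans (hδ.trans (by gcongr))

theorem IsCadlag.continuousAt {l : ℝ≥0 → ℝ} (hl : IsCadlag l) {s : ℝ≥0} (hs : ¬ IsJumpTime l s) :
    ContinuousAt l s := by
  rw [continuousAt_iff_continuous_left_right, ← continuousWithinAt_Iio_iff_Iic]
  exact ⟨not_not.1 hs, hl.right_continuous s⟩

/-- Without jumps the path is uniformly continuous, so that its single nonzero increment on a grid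
tends to `0` with the mesh: the path is constant. -/
theorem IsCadlag.eq_of_not_isJumpTime {l : ℝ≥0 → ℝ} (hl : IsCadlag l) {k : ℕ} {δ : ℝ≥0}
    (h : ∃ᶠ n in atTop, SparseOnGrid l k n δ) {u v : ℝ≥0} (hku : k ≤ u) (huv : u ≤ v)
    (hvk : v ≤ k + 1) (hvu : v ≤ u + δ) (hJ : ∀ s, u < s → s ≤ v → ¬ IsJumpTime l s) :
    l v = l u := by
  by_contra hne
  have hpos : 0 < dist (l v) (l u) := dist_pos.2 hne
  have hcont : ∀ x ∈ Set.Icc u v, ContinuousAt (fun y => l (max u y)) x := by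
    rintro x ⟨hux, hxv⟩
    rcases hux.eq_or_lt with rfl | hux
    · have : Tendsto (fun y => max u y) (𝓝 u) (𝓝[≥] u) := by
        refine tendsto_nhdsWithin_iff.2 ⟨?_,
          Eventually.of_forall fun y => Set.mem_Ici.2 (le_max_left _ _)⟩
        have : ContinuousAt (fun y => max u y) u := by fun_prop
        simpa [ContinuousAt] using this
      have h1 := (hl.right_continuous u).tendsto.comp this
      simpa [ContinuousAt, Function.comp_def] using h1
    · have h1 : ContinuousAt l (max u x) := by
        rw [max_eq_right hux.le]
        exact hl.continuousAt (hJ x hux hxv)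
      exact ContinuousAt.comp (f := fun y => max u y) h1 (by fun_prop)
  obtain ⟨η, hη, hη'⟩ := Metric.mem_uniformity_dist.1
    (isCompact_Icc.uniformContinuousAt_of_continuousAt _ hcont
      (Metric.dist_mem_uniformity (half_pos hpos)))
  have h1 := ((hl.tendsto_ceil v).dist (hl.tendsto_ceil u)).eventually_const_lt (half_lt_self hpos)
  have h2 : ∀ᶠ n : ℕ in atTop, (1 : ℝ) / n < η :=
    (_root_.tendsto_const_div_atTop_nhds_zero_nat (1 : ℝ)).eventually_lt_const hη
  obtain ⟨n, hn, hn1, hn2, hn0⟩ :=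
    (h.and_eventually (h1.and (h2.and (eventually_gt_atTop 0)))).exists
  have hn' : (0 : ℝ≥0) < n := by positivity
  have hAB : ⌈u * n⌉₊ ≤ ⌈v * n⌉₊ := Nat.ceil_mono (by gcongr)
  rcases hAB.eq_or_lt with heq | hlt
  · rw [heq, dist_self] at hn1
    exact absurd hn1 (not_lt.2 (half_pos hpos).le)
  obtain ⟨i, hi1, hi2, hi3, hi4⟩ := hn.exists_step hlt
    (by
      have h3 : ((k * n : ℕ) : ℝ≥0) ≤ ⌈u * n⌉₊ := by
        refine le_trans ?_ (Nat.le_ceil _)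
        push_cast
        gcongr
      exact_mod_cast h3)
    (by
      rw [Nat.ceil_le]
      push_cast
      gcongr)
    (by
      calc (⌈v * n⌉₊ : ℝ≥0) ≤ v * n + 1 := (Nat.ceil_lt_add_one zero_le).le
        _ ≤ (u + δ) * n + 1 := by gcongr
        _ = u * n + δ * n + 1 := by ring
        _ ≤ _ := by gcongr; exact Nat.le_ceil _)
  have hui : u ≤ i / n := by
    rw [le_div_iff₀ hn']
    exact Nat.ceil_le.1 hi1
  have hiv : (i : ℝ≥0) / n ≤ v := by
    rw [div_le_iff₀ hn']
    exact (Nat.lt_ceil.1 hi2).le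
  have hd : dist ((i : ℝ≥0) / n) ((i + 1 : ℕ) / n) < η := by
    refine lt_of_eq_of_lt ?_ hn2
    rw [NNReal.dist_eq]
    push_cast
    rw [← sub_div, abs_div, Nat.abs_cast]
    norm_num
  have h3 : (((i : ℝ≥0) / n, ((i + 1 : ℕ) : ℝ≥0) / n) : ℝ≥0 × ℝ≥0) ∈ _ := hη' hd
  have h4 : dist (l (max u (i / n))) (l (max u ((i + 1 : ℕ) / n))) < dist (l v) (l u) / 2 :=
    h3 ⟨hui, hiv⟩
  rw [max_eq_right hui, max_eq_right (hui.trans (by gcongr; simp)), hi3, hi4, dist_comm] at h4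
  exact lt_asymm h4 hn1

/-! ### Successive jump times -/

theorem IsCadlag.not_isJumpTime_of_isJumpTime {l : ℝ≥0 → ℝ} (hl : IsCadlag l) {k : ℕ} {δ : ℝ≥0}
    (h : ∃ᶠ n in atTop, SparseOnGrid l k n δ) {s s' : ℝ≥0} (hs : IsJumpTime l s)
    (hks : k < s) (hsk : s ≤ k + 1) (hss' : s < s') (hs's : s' ≤ s + δ) : ¬ IsJumpTime l s' := by
  refine not_not.2 (Tendsto.congr' ?_ (tendsto_const_nhds (x := l s')))
  have : Set.Ioo s s' ∈ 𝓝[<] s' := Ioo_mem_nhdsLT hss'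
  filter_upwards [this] with u hu
  rw [hl.eq_of_isJumpTime h hs hks hsk hss'.le hs's,
    hl.eq_of_isJumpTime h hs hks hsk hu.1.le (hu.2.le.trans hs's)]

theorem IsCadlag.eq_of_forall_not_isJumpTime {l : ℝ≥0 → ℝ} (hl : IsCadlag l) {k : ℕ} {δ : ℝ≥0}
    (hδ : 0 < δ) (h : ∃ᶠ n in atTop, SparseOnGrid l k n δ)
    (hJ : ∀ s : ℝ≥0, k < s → s ≤ k + 1 → ¬ IsJumpTime l s) : l (k + 1) = l k := by
  obtain ⟨N, hN⟩ := exists_nat_gt (1 / δ)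
  have hN0 : 0 < N := by
    rcases Nat.eq_zero_or_pos N with rfl | h
    · simp at hN
    · exact h
  have hN' : (0 : ℝ≥0) < N := by positivity
  have hNδ : 1 / (N : ℝ≥0) ≤ δ := by
    rw [div_le_iff₀ hN']
    rw [div_lt_iff₀ hδ, mul_comm] at hN
    exact hN.le
  have hstep : ∀ j, 0 ≤ j → j < N → l (k + (j + 1 : ℕ) / N) = l (k + j / N) := by
    intro j _ hj
    have hj1 : ((j + 1 : ℕ) : ℝ≥0) / N ≤ 1 := by
      rw [div_le_one₀ hN']
      exact_mod_cast hj
    refine hl.eq_of_not_isJumpTime h (by simp) (by gcongr; simp) (by gcongr) ?_ ?_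
    · push_cast
      rw [add_div, ← add_assoc]
      gcongr
    · intro s hs1 hs2
      exact hJ s (lt_of_le_of_lt (by simp) hs1) (hs2.trans (by gcongr))
  have h1 := eq_of_forall_succ_eq (f := fun j : ℕ => l (k + j / N)) (Nat.zero_le N) hstep
  simpa [div_self hN'.ne'] using h1

theorem finite_of_separated {s : Set ℝ≥0} {δ T : ℝ≥0} (hδ : 0 < δ) (hT : ∀ x ∈ s, x ≤ T)
    (hs : ∀ x ∈ s, ∀ y ∈ s, x < y → x + δ < y) : s.Finite := by
  refine Set.Finite.of_injOn (f := fun x => ⌊x / δ⌋₊) (t := Set.Iic ⌊T / δ⌋₊) ?_ ?_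
    (Set.finite_Iic _)
  · intro x hx
    exact Nat.floor_mono (by gcongr; exact hT x hx)
  · have key : ∀ x ∈ s, ∀ y ∈ s, x < y → ⌊x / δ⌋₊ ≠ ⌊y / δ⌋₊ := by
      intro x hx y hy hxy heq
      have h1 : y / δ < ⌊y / δ⌋₊ + 1 := Nat.lt_floor_add_one _
      have h2 : (⌊x / δ⌋₊ : ℝ≥0) ≤ x / δ := Nat.floor_le zero_le
      rw [← heq] at h1
      have h3 : y / δ < x / δ + 1 := h1.trans_le (by gcongr)
      rw [div_lt_iff₀ hδ, add_mul, div_mul_cancel₀ _ hδ.ne', one_mul] at h3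
      exact lt_asymm h3 (hs x hx y hy hxy)
    intro x hx y hy hxy
    rcases lt_trichotomy x y with h | h | h
    · exact absurd hxy (key x hx y hy h)
    · exact h
    · exact absurd hxy.symm (key y hy x hx h)

theorem finite_jumpTimes_le {l : ℝ≥0 → ℝ}
    (hsep : ∀ k : ℕ, ∃ δ : ℝ≥0, 0 < δ ∧ ∀ s s', IsJumpTime l s → IsJumpTime l s' →
      k < s → s ≤ k + 1 → s < s' → s + δ < s') (T : ℝ≥0) :
    {s | IsJumpTime l s ∧ s ≤ T}.Finite := by
  have h1 : ∀ k : ℕ, {s : ℝ≥0 | IsJumpTime l s ∧ k < s ∧ s ≤ k + 1}.Finite := by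
    intro k
    obtain ⟨δ, hδ, h⟩ := hsep k
    exact finite_of_separated hδ (fun x hx => hx.2.2)
      fun x hx y hy hxy => h x y hx.1 hy.1 hx.2.1 hx.2.2 hxy
  refine ((Set.finite_Iio ⌈T⌉₊).biUnion fun k _ => h1 k).subset ?_
  rintro s ⟨hs, hsT⟩
  have hs0 : 0 < ⌈s⌉₊ := Nat.ceil_pos.2 (isJumpTime_pos hs)
  simp only [Set.mem_iUnion]
  refine ⟨⌈s⌉₊ - 1, ?_, hs, ?_, ?_⟩
  · have := Nat.ceil_mono hsT
    simp only [Set.mem_Iio]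
    omega
  · rw [← Nat.lt_ceil]
    omega
  · have : ((⌈s⌉₊ - 1 : ℕ) : ℝ≥0) + 1 = ⌈s⌉₊ := by
      exact_mod_cast Nat.sub_add_cancel hs0
    rw [this]
    exact Nat.le_ceil s

theorem exists_jumpTime_succ {l : ℝ≥0 → ℝ} (hfin : ∀ T, {s | IsJumpTime l s ∧ s ≤ T}.Finite)
    (hunb : ∀ T : ℝ≥0, ∃ s, T < s ∧ IsJumpTime l s) {n : ℕ} {r : ℝ≥0} (hr : jumpTime l n = r) :
    ∃ s : ℝ≥0, IsJumpTime l s ∧ r < s ∧ jumpTime l (n + 1) = s := by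
  obtain ⟨s₀, hs₀, hJs₀⟩ := hunb r
  obtain ⟨s, ⟨⟨hs, hss₀⟩, hrs⟩, hmin⟩ := Set.exists_min_image
    ({s | IsJumpTime l s ∧ s ≤ s₀} ∩ {s | r < s}) id ((hfin s₀).inter_of_left _)
    ⟨s₀, ⟨hJs₀, le_rfl⟩, hs₀⟩
  refine ⟨s, hs, hrs, ?_⟩
  rw [jumpTime, hr]
  refine IsLeast.csInf_eq ⟨⟨s, ⟨hs, by exact_mod_cast hrs⟩, rfl⟩, ?_⟩
  rintro _ ⟨s', ⟨hs', hrs'⟩, rfl⟩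
  have hrs' : r < s' := by exact_mod_cast hrs'
  rw [ENNReal.coe_le_coe]
  rcases le_total s' s₀ with h | h
  · exact hmin s' ⟨⟨hs', h⟩, hrs'⟩
  · exact hss₀.trans h

theorem exists_strictMono_jumpTime {l : ℝ≥0 → ℝ}
    (hfin : ∀ T, {s | IsJumpTime l s ∧ s ≤ T}.Finite)
    (hunb : ∀ T : ℝ≥0, ∃ s, T < s ∧ IsJumpTime l s) :
    ∃ r : ℕ → ℝ≥0, (∀ n, jumpTime l n = r n) ∧ (∀ n, IsJumpTime l (r (n + 1))) ∧
      Tendsto r atTop atTop := by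
  have h0 : ∀ n, ∃ r : ℝ≥0, jumpTime l n = r := by
    intro n
    induction n with
    | zero => exact ⟨0, rfl⟩
    | succ n ih =>
      obtain ⟨r, hr⟩ := ih
      obtain ⟨s, -, -, hs⟩ := exists_jumpTime_succ hfin hunb hr
      exact ⟨s, hs⟩
  choose r hr using h0
  have h1 : ∀ n, IsJumpTime l (r (n + 1)) ∧ r n < r (n + 1) := by
    intro n
    obtain ⟨s, hs1, hs2, hs3⟩ := exists_jumpTime_succ hfin hunb (hr n)
    rw [hr (n + 1), ENNReal.coe_inj] at hs3
    subst hs3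
    exact ⟨hs1, hs2⟩
  have hmono : StrictMono r := strictMono_nat_of_lt_succ fun n => (h1 n).2
  refine ⟨r, hr, fun n => (h1 n).1, tendsto_atTop_atTop_of_monotone hmono.monotone fun T => ?_⟩
  by_contra! hcon
  have hinf : (Set.range fun n => r (n + 1)).Infinite :=
    Set.infinite_range_of_injective fun a b hab => by simpa using hmono.injective hab
  refine hinf ((hfin T).subset ?_)
  rintro _ ⟨n, rfl⟩
  exact ⟨(h1 n).1, (hcon _).le⟩

/-! ### The line `t ↦ X (1, …, 1, t)` -/

theorem continuous_linePoint (m : ℕ) : Continuous (linePoint m) :=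
  continuous_const.update _ continuous_id

theorem linePoint_last (m : ℕ) (t : ℝ≥0) : linePoint m t (Fin.last m) = t := by
  simp [linePoint]

theorem linePoint_of_ne {m : ℕ} (t : ℝ≥0) {i : Fin (m + 1)} (hi : i ≠ Fin.last m) :
    linePoint m t i = 1 := by
  simp [linePoint, hi]

theorem IsLamp.isCadlag {m : ℕ} {x : (Fin (m + 1) → ℝ≥0) → ℝ} (hx : IsLamp x) :
    IsCadlag fun t => x (linePoint m t) := by
  have hc : ∀ t, Tendsto (linePoint m) (𝓝 t) (𝓝 (linePoint m t)) :=
    fun t => (continuous_linePoint m).tendsto t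
  refine ⟨fun t => ?_, fun t => ?_⟩
  · refine hx.tendsto_of_ge ((hc t).mono_left nhdsWithin_le_nhds) ?_
    filter_upwards [self_mem_nhdsWithin] with u hu
    exact _root_.update_le_update_iff'.2 hu
  · obtain ⟨y, hy⟩ := hx.exists_limit (Function.update (fun _ => true) (Fin.last m) false)
      (linePoint m t)
    refine ⟨y, hy.comp (tendsto_nhdsWithin_iff.2
      ⟨(hc t).mono_left nhdsWithin_le_nhds, ?_⟩)⟩
    filter_upwards [self_mem_nhdsWithin] with u hu i
    by_cases hi : i = Fin.last m
    · subst hi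
      simpa [linePoint_last] using hu
    · simp [hi, linePoint_of_ne]

theorem IsLamp.increment_linePoint {m : ℕ} {x : (Fin (m + 1) → ℝ≥0) → ℝ} (hx : IsLamp x)
    (s t : ℝ≥0) : increment x (Pi.single (Fin.last m) s) (linePoint m t) =
      x (linePoint m t) - x (linePoint m s) := by
  rw [increment_single hx]
  simp [linePoint]

theorem single_le_linePoint (m : ℕ) {s t : ℝ≥0} (hst : s ≤ t) :
    Pi.single (Fin.last m) s ≤ linePoint m t := by
  intro i
  by_cases hi : i = Fin.last m
  · subst hi
    simpa [linePoint_last] using hst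
  · simp [hi]

theorem prod_linePoint_sub_single (m : ℕ) (s t : ℝ≥0) :
    ∏ i, (linePoint m t i - (Pi.single (Fin.last m) s : Fin (m + 1) → ℝ≥0) i) = t - s := by
  rw [Fin.prod_univ_castSucc]
  simp [linePoint_last, linePoint_of_ne, Fin.castSucc_ne_last]

theorem disjoint_box_line (m : ℕ) {c : ℕ → ℝ≥0} (hc : Monotone c) {j k : ℕ} (hjk : j < k) :
    Disjoint (box (Pi.single (Fin.last m) (c j)) (linePoint m (c (j + 1))))
      (box (Pi.single (Fin.last m) (c k)) (linePoint m (c (k + 1)))) := by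
  rw [Set.disjoint_left]
  intro t ht ht'
  have h1 := (ht (Fin.last m)).2
  have h2 := (ht' (Fin.last m)).1
  rw [linePoint_last] at h1
  rw [Pi.single_eq_same] at h2
  exact absurd (h1.trans (hc hjk)) (not_le.2 h2)

/-- The jump times of the line are separated, by sparseness, and unbounded, since the path would
otherwise be constant from some time on. -/
theorem exists_jumpTime_eq {m : ℕ} {x : (Fin (m + 1) → ℝ≥0) → ℝ} (hx : IsLamp x)
    (hsparse : ∀ k : ℕ, ∃ δ : ℝ≥0, 0 < δ ∧
      ∃ᶠ n in atTop, SparseOnGrid (fun t => x (linePoint m t)) k n δ)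
    (hne : ∀ T : ℕ, ∃ k ≥ T, x (linePoint m (k + 1 : ℕ)) ≠ x (linePoint m k)) :
    ∃ r : ℕ → ℝ≥0, (∀ n, jumpTime (fun t => x (linePoint m t)) n = r n) ∧
      (∀ n, IsJumpTime (fun t => x (linePoint m t)) (r (n + 1))) ∧ Tendsto r atTop atTop := by
  refine exists_strictMono_jumpTime (finite_jumpTimes_le fun k => ?_) fun T => ?_
  · obtain ⟨δ, hδ, h⟩ := hsparse k
    refine ⟨δ, hδ, fun s s' hs hs' hks hsk hss' => ?_⟩
    by_contra! hcon
    exact hx.isCadlag.not_isJumpTime_of_isJumpTime h hs hks hsk hss' hcon hs'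
  · obtain ⟨k, hk, hk'⟩ := hne ⌈T⌉₊
    obtain ⟨δ, hδ, h⟩ := hsparse k
    by_contra! hcon
    refine hk' ?_
    have h1 := hx.isCadlag.eq_of_forall_not_isJumpTime hδ h
      fun s hs _ => hcon s (lt_of_le_of_lt (Nat.ceil_le.1 hk) hs)
    simpa using h1

section Line

variable {m : ℕ} {Ω : Type*} [MeasurableSpace Ω] {P : Measure Ω}
  {X : (Fin (m + 1) → ℝ≥0) → Ω → ℝ}

theorem ae_increment_linePoint (hlamp : ∀ᵐ ω ∂P, IsLamp (fun t => X t ω)) (s t : ℝ≥0) :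
    (fun ω => increment (fun t => X t ω) (Pi.single (Fin.last m) s) (linePoint m t)) =ᵐ[P]
      fun ω => X (linePoint m t) ω - X (linePoint m s) ω := by
  filter_upwards [hlamp] with ω hω
  exact hω.increment_linePoint s t

theorem iIndepFun_line (hX : IsLevyField P X) {c : ℕ → ℝ≥0} (hc : Monotone c) (N : ℕ) :
    iIndepFun (fun (k : Fin N) ω =>
      X (linePoint m (c (k + 1))) ω - X (linePoint m (c k)) ω) P := by
  refine (hX.indep_increments N (fun k => Pi.single (Fin.last m) (c k))
    (fun k => linePoint m (c (k + 1))) (fun k => single_le_linePoint m (hc (Nat.le_succ _)))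
    fun j k hjk => ?_).congr fun k => ae_increment_linePoint hX.lamp _ _
  rcases lt_or_gt_of_ne hjk with h | h
  · exact disjoint_box_line m hc h
  · exact (disjoint_box_line m hc h).symm

theorem measure_line_ne_le (hlamp : ∀ᵐ ω ∂P, IsLamp (fun t => X t ω)) {K : ℝ≥0}
    (hK : HasIncrementBound P X K)
    {s t : ℝ≥0} (hst : s ≤ t) :
    P {ω | X (linePoint m t) ω - X (linePoint m s) ω ≠ 0} ≤ ((K * (t - s) : ℝ≥0) : ℝ≥0∞) := by
  have h := hK _ _ (single_le_linePoint m hst)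
  rw [prod_linePoint_sub_single] at h
  refine le_trans (measure_mono_ae ?_) h
  filter_upwards [ae_increment_linePoint hlamp s t] with ω hω hne
  change increment _ _ _ ≠ 0
  rw [hω]
  exact hne

theorem measure_line_ne_and_ne_le (hX : IsLevyField P X) {K : ℝ≥0}
    (hK : HasIncrementBound P X K)
    {n : ℕ} {i j : ℕ} (hij : i < j) :
    P {ω | X (linePoint m ((i + 1 : ℕ) / n)) ω - X (linePoint m (i / n)) ω ≠ 0 ∧
      X (linePoint m ((j + 1 : ℕ) / n)) ω - X (linePoint m (j / n)) ω ≠ 0} ≤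
      (((K / n) ^ 2 : ℝ≥0) : ℝ≥0∞) := by
  have hmono : Monotone fun k : ℕ => (k : ℝ≥0) / n := fun a b hab => by
    have : (a : ℝ≥0) ≤ b := by exact_mod_cast hab
    dsimp only
    gcongr
  have hind := (iIndepFun_line hX hmono (j + 1)).indepFun
    (i := ⟨i, by omega⟩) (j := ⟨j, by omega⟩) (by simp; omega)
  have hm : MeasurableSet {x : ℝ | x ≠ 0} := (measurableSet_singleton 0).compl
  have h1 := hind.measure_inter_preimage_eq_mul _ _ hm hm
  have hb : ∀ k : ℕ, P {ω | X (linePoint m ((k + 1 : ℕ) / n)) ω - X (linePoint m (k / n)) ω ≠ 0} ≤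
      ((K / n : ℝ≥0) : ℝ≥0∞) := by
    intro k
    refine (measure_line_ne_le hX.lamp hK (hmono (Nat.le_succ k))).trans (le_of_eq ?_)
    congr 1
    push_cast
    rw [add_div, add_tsub_cancel_left, mul_one_div]
  calc _ = _ := h1
    _ ≤ ((K / n : ℝ≥0) : ℝ≥0∞) * ((K / n : ℝ≥0) : ℝ≥0∞) := mul_le_mul' (hb i) (hb j)
    _ = _ := by rw [← ENNReal.coe_mul, sq]

/-- Union bound over the `n (δ n + 1)` pairs of increments; by independence both members of a pair
are nonzero with probability at most `(K / n) ^ 2`. -/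
theorem measure_not_sparseOnGrid_le (hX : IsLevyField P X) {K : ℝ≥0}
    (hK : HasIncrementBound P X K)
    (k : ℕ) {n : ℕ} (hn : 0 < n) (δ : ℝ≥0) :
    P {ω | ¬ SparseOnGrid (fun t => X (linePoint m t) ω) k n δ} ≤
      ((K ^ 2 * (δ + 1 / n) : ℝ≥0) : ℝ≥0∞) := by
  have hn' : (n : ℝ≥0) ≠ 0 := by positivity
  set r : ℕ := ⌊δ * n⌋₊ + 1 with hr
  have hsub : {ω | ¬ SparseOnGrid (fun t => X (linePoint m t) ω) k n δ} ⊆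
      ⋃ i ∈ Finset.Ico (k * n) ((k + 1) * n), ⋃ j ∈ Finset.Ioc i (i + r),
        {ω | X (linePoint m ((i + 1 : ℕ) / n)) ω - X (linePoint m (i / n)) ω ≠ 0 ∧
          X (linePoint m ((j + 1 : ℕ) / n)) ω - X (linePoint m (j / n)) ω ≠ 0} := by
    intro ω hω
    have hω' : ¬ SparseOnGrid (fun t => X (linePoint m t) ω) k n δ := hω
    unfold SparseOnGrid at hω'
    push Not at hω'
    obtain ⟨i, j, h1, h2, h3, h4, h5, h6⟩ := hω'
    simp only [Set.mem_iUnion]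
    refine ⟨i, Finset.mem_Ico.2 ⟨h1, h2⟩, j, Finset.mem_Ioc.2 ⟨h3, ?_⟩,
      sub_ne_zero.2 h5, sub_ne_zero.2 h6⟩
    have h7 : ((j - i - 1 : ℕ) : ℝ≥0) ≤ δ * n := by
      rw [Nat.cast_tsub, Nat.cast_tsub, Nat.cast_one, tsub_le_iff_right, tsub_le_iff_left,
        ← add_assoc]
      exact h4
    have h8 := Nat.le_floor h7
    omega
  refine (measure_mono hsub).trans ?_
  refine (measure_biUnion_finset_le _ _).trans ?_
  refine (Finset.sum_le_sum fun i _ => (measure_biUnion_finset_le _ _).trans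
    (Finset.sum_le_sum fun j hj =>
      measure_line_ne_and_ne_le hX hK (n := n) (Finset.mem_Ioc.1 hj).1)).trans ?_
  simp only [Finset.sum_const, Nat.card_Ioc, Nat.card_Ico, add_tsub_cancel_left, nsmul_eq_mul]
  rw [← Nat.sub_mul, Nat.add_sub_cancel_left, one_mul, ← ENNReal.coe_natCast,
    ← ENNReal.coe_natCast, ← ENNReal.coe_mul, ← ENNReal.coe_mul, ENNReal.coe_le_coe]
  have h9 : (r : ℝ≥0) ≤ δ * n + 1 := by
    rw [hr]
    push_cast
    gcongr
    exact Nat.floor_le zero_le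
  calc (n : ℝ≥0) * (r * (K / n) ^ 2) ≤ n * ((δ * n + 1) * (K / n) ^ 2) := by gcongr
    _ = K ^ 2 * (δ + 1 / n) := by field_simp

/-- In the limit of fine grids, the probability of two nonzero increments at distance at most `δ`
is of order `δ`. -/
theorem measure_eventually_not_sparseOnGrid_le (hX : IsLevyField P X) {K : ℝ≥0}
    (hK : HasIncrementBound P X K)
    (k : ℕ) {δ : ℝ≥0} (hδ : 0 < δ) :
    P {ω | ¬ ∃ᶠ n in atTop, SparseOnGrid (fun t => X (linePoint m t) ω) k n δ} ≤
      ((K ^ 2 * (2 * δ) : ℝ≥0) : ℝ≥0∞) := by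
  simp only [not_frequently]
  refine measure_setOf_eventually_mem_le P
    (fun n => {ω | ¬ SparseOnGrid (fun t => X (linePoint m t) ω) k n δ}) _ ?_
  have h1 : ∀ᶠ n : ℕ in atTop, (1 : ℝ≥0) / n < δ :=
    (_root_.tendsto_const_div_atTop_nhds_zero_nat (1 : ℝ≥0)).eventually_lt_const hδ
  filter_upwards [h1, eventually_gt_atTop 0] with n hn hn0
  refine (measure_not_sparseOnGrid_le hX hK k hn0 δ).trans ?_
  rw [ENNReal.coe_le_coe, two_mul]
  gcongr

theorem ae_exists_sparseOnGrid (hX : IsLevyField P X) {K : ℝ≥0}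
    (hK : HasIncrementBound P X K) :
    ∀ᵐ ω ∂P, ∀ k : ℕ, ∃ δ : ℝ≥0, 0 < δ ∧
      ∃ᶠ n in atTop, SparseOnGrid (fun t => X (linePoint m t) ω) k n δ := by
  rw [ae_all_iff]
  intro k
  rw [ae_iff]
  have hlim : Tendsto (fun N : ℕ => ((K ^ 2 * (2 * (1 / ((N : ℝ≥0) + 1))) : ℝ≥0) : ℝ≥0∞)) atTop
      (𝓝 0) := by
    rw [← ENNReal.coe_zero, ENNReal.tendsto_coe]
    have h1 := (tendsto_one_div_add_atTop_nhds_zero_nat (𝕜 := ℝ≥0)).const_mul (2 : ℝ≥0)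
    simpa using h1.const_mul (K ^ 2)
  refine le_antisymm (ge_of_tendsto' hlim fun N => ?_) zero_le
  refine (measure_mono fun ω hω hfr => ?_).trans
    (measure_eventually_not_sparseOnGrid_le hX hK k (δ := 1 / ((N : ℝ≥0) + 1)) (by positivity))
  exact hω ⟨_, by positivity, hfr⟩

theorem identDistrib_line (hX : IsLevyField P X) (k : ℕ) :
    IdentDistrib (fun ω => X (linePoint m (k + 1 : ℕ)) ω - X (linePoint m k) ω)
      (X (linePoint m 1)) P P := by
  have hst := hX.stationary_increments (Pi.single (Fin.last m) 0) (linePoint m 1)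
    (Pi.single (Fin.last m) k) (linePoint m (k + 1 : ℕ)) (Pi.single (Fin.last m) (k : ℝ))
    (single_le_linePoint m zero_le) (single_le_linePoint m (by simp))
    (fun i => by by_cases hi : i = Fin.last m <;> simp [hi])
    (fun i => by
      by_cases hi : i = Fin.last m
      · subst hi; simp [linePoint_last, add_comm]
      · simp [hi, linePoint_of_ne])
  have h1 : (fun ω => increment (fun t => X t ω) (Pi.single (Fin.last m) 0) (linePoint m 1)) =ᵐ[P]
      X (linePoint m 1) := by
    filter_upwards [hX.lamp] with ω hω
    rw [Pi.single_zero, increment_zero hω]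
  have hmk : Measurable fun ω => X (linePoint m (k + 1 : ℕ)) ω - X (linePoint m k) ω :=
    (hX.measurable _).sub (hX.measurable _)
  exact (IdentDistrib.of_ae_eq hmk.aemeasurable
    (ae_increment_linePoint hX.lamp _ _).symm).trans (hst.symm.trans
      (IdentDistrib.of_ae_eq hst.aemeasurable_fst h1))

/-- The increments over `[k, k + 1]` are independent with the same law, which is not `δ₀`. -/
theorem ae_frequently_line_ne [IsProbabilityMeasure P] (hX : IsLevyField P X)
    (hlt : P {ω | X (linePoint m 1) ω = 0} < 1) :
    ∀ᵐ ω ∂P, ∀ T : ℕ, ∃ k ≥ T, X (linePoint m (k + 1 : ℕ)) ω ≠ X (linePoint m k) ω := by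
  have hm : MeasurableSet ({0} : Set ℝ) := measurableSet_singleton 0
  rw [ae_all_iff]
  intro T
  rw [ae_iff]
  refine le_antisymm (ge_of_tendsto' (ENNReal.tendsto_pow_atTop_nhds_zero_of_lt_one hlt)
    fun N => ?_) zero_le
  have hmono : Monotone fun k : ℕ => ((T + k : ℕ) : ℝ≥0) := fun a b hab => by
    dsimp only
    exact_mod_cast Nat.add_le_add_left hab T
  have hind := (iIndepFun_line hX hmono N).measure_inter_preimage_eq_mul Finset.univ
    (sets := fun _ => {0}) (fun _ _ => hm)
  have hprod : ∀ k : Fin N, P ((fun ω => X (linePoint m ((T + (k + 1) : ℕ) : ℝ≥0)) ω -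
      X (linePoint m ((T + k : ℕ) : ℝ≥0)) ω) ⁻¹' {0}) = P {ω | X (linePoint m 1) ω = 0} :=
    fun k => (identDistrib_line hX (T + k)).measure_mem_eq hm
  simp only [hprod, Finset.prod_const, Finset.card_univ, Fintype.card_fin] at hind
  rw [← hind]
  refine measure_mono fun ω hω => ?_
  have hω' : ¬ ∃ k ≥ T, X (linePoint m (k + 1 : ℕ)) ω ≠ X (linePoint m k) ω := hω
  push Not at hω'
  simp only [Set.mem_iInter]
  intro k _
  exact sub_eq_zero.2 (hω' (T + k) (by omega))

end Line

/-! ### Bumps on small boxes -/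

theorem partialDeriv_prod {d : ℕ} {g : Fin d → ℝ → ℝ} (hg : ∀ i, Differentiable ℝ (g i))
    (j : Fin d) : partialDeriv j (fun t => ∏ i, g i (t i)) =
      fun t => ∏ i, Function.update g j (deriv (g j)) i (t i) := by
  ext t
  have h1 : ∀ i ∈ (Finset.univ : Finset (Fin d)), HasFDerivAt (fun t : Fin d → ℝ => g i (t i))
      (deriv (g i) (t i) • ContinuousLinearMap.proj (R := ℝ) (φ := fun _ : Fin d => ℝ) i) t :=
    fun i _ => (hg i (t i)).hasDerivAt.comp_hasFDerivAt t
      (ContinuousLinearMap.proj (R := ℝ) (φ := fun _ : Fin d => ℝ) i).hasFDerivAt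
  unfold partialDeriv
  rw [(HasFDerivAt.finsetProd h1).fderiv, sum_apply,
    Finset.sum_eq_single j]
  · rw [← Finset.mul_prod_erase Finset.univ _ (Finset.mem_univ j)]
    simp only [smul_apply, ContinuousLinearMap.proj_apply, Pi.single_eq_same,
      smul_eq_mul, mul_one, Function.update_self]
    rw [mul_comm]
    congr 1
    refine Finset.prod_congr rfl fun i hi => ?_
    rw [Function.update_of_ne (Finset.ne_of_mem_erase hi)]
  · intro i _ hij
    simp [hij]
  · simp

theorem contDiff_iteratedDeriv_of_contDiff {f : ℝ → ℝ} (hf : ContDiff ℝ (⊤ : ℕ∞) f) (n : ℕ) :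
    ContDiff ℝ (⊤ : ℕ∞) (iteratedDeriv n f) := by
  induction n with
  | zero => simpa using hf
  | succ n ih =>
    rw [iteratedDeriv_succ]
    exact (contDiff_infty_iff_deriv.1 ih).2

theorem iterate_partialDeriv_prod {d : ℕ} {g : Fin d → ℝ → ℝ}
    (hg : ∀ i, ContDiff ℝ (⊤ : ℕ∞) (g i)) (j : Fin d) (k : ℕ) :
    (partialDeriv j)^[k] (fun t => ∏ i, g i (t i)) =
      fun t => ∏ i, Function.update g j (iteratedDeriv k (g j)) i (t i) := by
  induction k with
  | zero => simp
  | succ k ih =>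
    rw [Function.iterate_succ_apply', ih, partialDeriv_prod]
    · simp [iteratedDeriv_succ]
    · intro i
      by_cases hi : i = j
      · subst hi
        rw [Function.update_self]
        exact (contDiff_iteratedDeriv_of_contDiff (hg i) k).differentiable (by simp)
      · rw [Function.update_of_ne hi]
        exact (hg i).differentiable (by simp)

theorem multiDeriv_prod {d : ℕ} {g : Fin d → ℝ → ℝ} (hg : ∀ i, ContDiff ℝ (⊤ : ℕ∞) (g i))
    (β : Fin d → ℕ) : multiDeriv β (fun t => ∏ i, g i (t i)) =
      fun t => ∏ i, iteratedDeriv (β i) (g i) (t i) := by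
  have key : ∀ l : List (Fin d), l.Nodup →
      l.foldr (fun i g => (partialDeriv i)^[β i] g) (fun t => ∏ i, g i (t i)) =
      fun t => ∏ i, (if i ∈ l then iteratedDeriv (β i) (g i) else g i) (t i) := by
    intro l
    induction l with
    | nil => simp
    | cons j l ih =>
      intro hl
      obtain ⟨hj, hl⟩ := List.nodup_cons.1 hl
      rw [List.foldr_cons, ih hl, iterate_partialDeriv_prod]
      · ext t
        refine Finset.prod_congr rfl fun i _ => ?_
        by_cases hi : i = j
        · subst hi
          simp [hj]
        · simp [hi]
      · intro i
        split_ifs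
        · exact contDiff_iteratedDeriv_of_contDiff (hg i) _
        · exact hg i
  unfold multiDeriv
  rw [key _ (List.nodup_finRange d)]
  simp

/-- A smooth bump of integral one with support `[0, 1]`. -/
noncomputable def unitBump : ℝ → ℝ :=
  (⟨1 / 4, 1 / 2, by norm_num, by norm_num⟩ : ContDiffBump (1 / 2 : ℝ)).normed volume

theorem contDiff_unitBump : ContDiff ℝ (⊤ : ℕ∞) unitBump := ContDiffBump.contDiff_normed _

theorem integral_unitBump : ∫ x, unitBump x = 1 := ContDiffBump.integral_normed _

theorem tsupport_unitBump : tsupport unitBump = Set.Icc 0 1 := by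
  unfold unitBump
  rw [ContDiffBump.tsupport_normed_eq, Real.closedBall_eq_Icc]
  norm_num

theorem tsupport_iteratedDeriv_subset (f : ℝ → ℝ) (n : ℕ) :
    tsupport (iteratedDeriv n f) ⊆ tsupport f := by
  induction n with
  | zero => simp
  | succ n ih =>
    rw [iteratedDeriv_succ]
    exact (closure_minimal support_deriv_subset isClosed_closure).trans ih

theorem iteratedDeriv_unitBump_eq_zero (n : ℕ) {x : ℝ} (hx : x ∉ Set.Icc (0 : ℝ) 1) :
    iteratedDeriv n unitBump x = 0 := by
  refine image_eq_zero_of_notMem_tsupport fun h => hx ?_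
  rw [← tsupport_unitBump]
  exact tsupport_iteratedDeriv_subset _ n h

theorem exists_bound_iteratedDeriv_unitBump (p : ℕ) :
    ∃ M : ℝ≥0, ∀ n ≤ p, ∀ x, |iteratedDeriv n unitBump x| ≤ M := by
  have h1 : ∀ n, ∃ C : ℝ, ∀ x, ‖iteratedDeriv n unitBump x‖ ≤ C := fun n =>
    (contDiff_iteratedDeriv_of_contDiff contDiff_unitBump
      n).continuous.bounded_above_of_compact_support
      (HasCompactSupport.of_support_subset_isCompact (isCompact_Icc (a := (0 : ℝ)) (b := 1))
        fun x hx => by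
          by_contra h
          exact hx (iteratedDeriv_unitBump_eq_zero n h))
  choose C hC using h1
  refine ⟨∑ n ∈ Finset.range (p + 1), (C n).toNNReal, fun n hn x => ?_⟩
  refine (hC n x).trans ((Real.le_coe_toNNReal _).trans ?_)
  exact_mod_cast Finset.single_le_sum (f := fun n => (C n).toNNReal) (fun _ _ => zero_le)
    (Finset.mem_range.2 (Nat.lt_succ_of_le hn))

/-- The bump of integral one on the box of side `r⁻¹` with lower corner `c`, a product of rescaled
unit bumps. -/
noncomputable def boxBump {d : ℕ} (c : Fin d → ℝ) (r : ℝ) : (Fin d → ℝ) → ℝ :=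
  fun t => ∏ i, r * unitBump (r * (t i - c i))

theorem contDiff_scaled_unitBump (r c : ℝ) :
    ContDiff ℝ (⊤ : ℕ∞) fun x => r * unitBump (r * (x - c)) := by
  have := contDiff_unitBump
  fun_prop

theorem iteratedDeriv_scaled_unitBump (r c : ℝ) (n : ℕ) (x : ℝ) :
    iteratedDeriv n (fun x => r * unitBump (r * (x - c))) x =
      r ^ (n + 1) * iteratedDeriv n unitBump (r * (x - c)) := by
  rw [iteratedDeriv_const_mul_field, iteratedDeriv_comp_sub_const n (fun x => unitBump (r * x)) c,
    iteratedDeriv_comp_const_mul (contDiff_unitBump.of_le (by exact_mod_cast le_top)) r]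
  ring

theorem multiDeriv_boxBump {d : ℕ} (c : Fin d → ℝ) (r : ℝ) (β : Fin d → ℕ) (t : Fin d → ℝ) :
    multiDeriv β (boxBump c r) t =
      ∏ i, r ^ (β i + 1) * iteratedDeriv (β i) unitBump (r * (t i - c i)) := by
  unfold boxBump
  rw [multiDeriv_prod (g := fun i x => r * unitBump (r * (x - c i)))
    (fun i => contDiff_scaled_unitBump r (c i))]
  exact Finset.prod_congr rfl fun i _ => iteratedDeriv_scaled_unitBump r (c i) (β i) (t i)

theorem tsupport_boxBump_subset {d : ℕ} (c : Fin d → ℝ) {r : ℝ} (hr : 0 < r) :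
    tsupport (boxBump c r) ⊆ Set.Icc c (fun i => c i + r⁻¹) := by
  refine closure_minimal (fun t ht => ?_) isClosed_Icc
  have h1 : ∀ i, r * (t i - c i) ∈ Set.Icc (0 : ℝ) 1 := by
    intro i
    by_contra h
    refine ht (Finset.prod_eq_zero (Finset.mem_univ i) ?_)
    have := iteratedDeriv_unitBump_eq_zero 0 h
    rw [iteratedDeriv_zero] at this
    rw [this, mul_zero]
  refine ⟨fun i => ?_, fun i => ?_⟩
  · have := (h1 i).1
    exact sub_nonneg.1 ((mul_nonneg_iff_of_pos_left hr).1 this)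
  · have h2 := (h1 i).2
    rw [← le_div_iff₀' hr, one_div] at h2
    dsimp only
    linarith

theorem isTestFunction_boxBump {d : ℕ} (c : Fin d → ℝ) {r : ℝ} (hr : 0 < r) :
    IsTestFunction (boxBump c r) := by
  refine ⟨?_, isCompact_Icc.of_isClosed_subset isClosed_closure (tsupport_boxBump_subset c hr)⟩
  unfold boxBump
  have := contDiff_unitBump
  fun_prop

theorem integral_boxBump {d : ℕ} (c : Fin d → ℝ) {r : ℝ} (hr : 0 < r) :
    ∫ t, boxBump c r t = 1 := by
  unfold boxBump
  rw [integral_fintype_prod_volume_eq_prod (fun i x => r * unitBump (r * (x - c i)))]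
  refine Finset.prod_eq_one fun i _ => ?_
  rw [integral_const_mul, integral_sub_right_eq_self (fun x => unitBump (r * x)),
    Measure.integral_comp_mul_left, integral_unitBump, abs_of_pos (by positivity)]
  simp [hr.ne']

/-- On the support the monomials are at most `(2 T) ^ p`, and with the side `T⁻³` the derivatives
are at most `M ^ d (T ^ 3) ^ (d + p)`; together this is the exponent `3 d + 4 p`. -/
theorem exists_schwartzNorm_boxBump_le (d p : ℕ) : ∃ C : ℝ≥0, ∀ (c : Fin d → ℝ) (T : ℝ≥0),
    1 ≤ T → (∀ i, 0 ≤ c i) → (∀ i, c i ≤ T) →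
    schwartzNorm p (boxBump c (T ^ 3)) ≤ C * (T : ℝ≥0∞) ^ (3 * d + 4 * p) := by
  obtain ⟨M, hM⟩ := exists_bound_iteratedDeriv_unitBump p
  refine ⟨(multiIndices d p).card * ((multiIndices d p).card * (2 ^ p * M ^ d)),
    fun c T hT hc hcT => ?_⟩
  have hT' : (1 : ℝ) ≤ T := by exact_mod_cast hT
  have hT3 : (1 : ℝ) ≤ (T : ℝ) ^ 3 := one_le_pow₀ hT'
  have hmem : ∀ α ∈ multiIndices d p, ∑ i, α i ≤ p := fun α hα => (Finset.mem_filter.1 hα).2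
  have hterm : ∀ α ∈ multiIndices d p, ∀ β ∈ multiIndices d p,
      ⨆ t : Fin d → ℝ, ENNReal.ofReal |(∏ i, t i ^ α i) * multiDeriv β (boxBump c (T ^ 3)) t| ≤
      ((2 ^ p * M ^ d * T ^ (3 * d + 4 * p) : ℝ≥0) : ℝ≥0∞) := by
    intro α hα β hβ
    refine iSup_le fun t => ?_
    rw [← ENNReal.ofReal_coe_nnreal]
    refine ENNReal.ofReal_le_ofReal ?_
    have hβi : ∀ i, β i ≤ p := fun i =>
      (Finset.single_le_sum (fun _ _ => Nat.zero_le _) (Finset.mem_univ i)).trans (hmem β hβ)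
    have hfac : ∀ i ∈ (Finset.univ : Finset (Fin d)), |t i ^ α i * (((T : ℝ) ^ 3) ^ (β i + 1) *
        iteratedDeriv (β i) unitBump ((T : ℝ) ^ 3 * (t i - c i)))| ≤
        (2 * (T : ℝ)) ^ α i * (((T : ℝ) ^ 3) ^ (β i + 1) * M) := by
      intro i _
      by_cases h : (T : ℝ) ^ 3 * (t i - c i) ∈ Set.Icc (0 : ℝ) 1
      · have h1 : 0 ≤ t i - c i := (mul_nonneg_iff_of_pos_left (by positivity)).1 h.1
        have h2 : t i - c i ≤ 1 := by nlinarith [h.2]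
        have h3 : |t i| ≤ 2 * T := by
          rw [abs_of_nonneg (by linarith [hc i])]
          linarith [hcT i]
        rw [abs_mul, abs_mul, abs_pow, abs_of_pos (a := ((T : ℝ) ^ 3) ^ (β i + 1)) (by positivity)]
        gcongr
        exact hM _ (hβi i) _
      · rw [iteratedDeriv_unitBump_eq_zero _ h, mul_zero, mul_zero, abs_zero]
        positivity
    rw [multiDeriv_boxBump, ← Finset.prod_mul_distrib, Finset.abs_prod]
    refine (Finset.prod_le_prod (fun _ _ => abs_nonneg _) hfac).trans ?_
    rw [Finset.prod_mul_distrib, Finset.prod_mul_distrib, Finset.prod_pow_eq_pow_sum,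
      Finset.prod_pow_eq_pow_sum, Finset.prod_const, Finset.card_univ, Fintype.card_fin,
      Finset.sum_add_distrib]
    simp only [Finset.sum_const, Finset.card_univ, Fintype.card_fin, smul_eq_mul, mul_one]
    push_cast
    calc (2 * (T : ℝ)) ^ (∑ i, α i) * (((T : ℝ) ^ 3) ^ (∑ i, β i + d) * (M : ℝ) ^ d)
        ≤ (2 * (T : ℝ)) ^ p * (((T : ℝ) ^ 3) ^ (p + d) * (M : ℝ) ^ d) := by
          gcongr
          · linarith
          · exact hmem α hα
          · exact hmem β hβ
      _ = 2 ^ p * (M : ℝ) ^ d * (T : ℝ) ^ (3 * d + 4 * p) := by ring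
  unfold schwartzNorm
  refine (Finset.sum_le_sum fun α hα => Finset.sum_le_sum fun β hβ => hterm α hα β hβ).trans
    (le_of_eq ?_)
  simp only [Finset.sum_const, nsmul_eq_mul]
  push_cast
  ring

theorem schwartzNorm_zero (d p : ℕ) : schwartzNorm p (fun _ : Fin d → ℝ => 0) = 0 := by
  have h : ∀ β : Fin d → ℕ, multiDeriv β (fun _ : Fin d → ℝ => 0) = fun _ => 0 := by
    intro β
    have h0 : ∀ i : Fin d, partialDeriv i (fun _ : Fin d → ℝ => 0) = fun _ => 0 := by
      intro i
      ext t
      simp [partialDeriv]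
    unfold multiDeriv
    induction List.finRange d with
    | nil => rfl
    | cons j l ih => rw [List.foldr_cons, ih, Function.iterate_fixed (h0 j)]
  simp [schwartzNorm, h]

/-! ### The exceptional sets and their summability -/

section Sheet

variable {m : ℕ} {Ω : Type*}
  {X : (Fin (m + 1) → ℝ≥0) → Ω → ℝ}

/-- The side lengths of the slab in the direction `j` that is used for jump times near `k + 1`:
`(k + 1)⁻³` in the direction `j`, `k + 3` in the last direction and `2` in the others. -/
noncomputable def slabSides (m k : ℕ) (j : Fin (m + 1)) : Fin (m + 1) → ℝ≥0 :=
  fun i => if i = j then 1 / ((k : ℝ≥0) + 1) ^ 3 else if i = Fin.last m then k + 3 else 2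

/-- The exceptional set at the scale `δ = (k + 1)⁻³`: either on every sufficiently fine grid the
line `t ↦ X (1, …, 1, t)` has two nonzero increments at distance at most about `δ`, the first of
them in `[k + 1, k + 2]`, or `X` depends on some coordinate `j` other than the last in the slab
`1 ≤ t j ≤ 1 + δ`. -/
def badSet (X : (Fin (m + 1) → ℝ≥0) → Ω → ℝ) (k : ℕ) : Set Ω :=
  {ω | ¬ ∃ᶠ n in atTop, SparseOnGrid (fun t => X (linePoint m t) ω) (k + 1) n
      (1 / ((k : ℝ≥0) + 1) ^ 3)} ∪
    ⋃ j ∈ Finset.univ.erase (Fin.last m), {ω | ∃ t : Fin (m + 1) → ℝ≥0,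
      t ≤ Pi.single j 1 + slabSides m k j ∧ 1 ≤ t j ∧ X t ω ≠ X (Function.update t j 1) ω}

/-- Off the exceptional set, the coordinates in `[1, 1 + δ]` can be reset to `1` one at a time. -/
theorem eq_linePoint_of_notMem_badSet {k : ℕ} {ω : Ω} (hω : ω ∉ badSet X k)
    {t : Fin (m + 1) → ℝ≥0} (ht1 : ∀ i ≠ Fin.last m, 1 ≤ t i)
    (ht2 : ∀ i ≠ Fin.last m, t i ≤ 1 + 1 / ((k : ℝ≥0) + 1) ^ 3)
    (ht3 : t (Fin.last m) ≤ k + 3) : X t ω = X (linePoint m (t (Fin.last m))) ω := by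
  have hslab : ∀ j ≠ Fin.last m, ∀ t : Fin (m + 1) → ℝ≥0,
      t ≤ Pi.single j 1 + slabSides m k j → 1 ≤ t j → X t ω = X (Function.update t j 1) ω := by
    intro j hj t h1 h2
    by_contra hne
    refine hω (Or.inr ?_)
    simp only [Set.mem_iUnion]
    exact ⟨j, by simp [hj], t, h1, h2, hne⟩
  have hε : 1 / ((k : ℝ≥0) + 1) ^ 3 ≤ 1 := by
    rw [div_le_one₀ (by positivity)]
    exact one_le_pow₀ (by simp)
  have key : ∀ s : Finset (Fin (m + 1)), Fin.last m ∉ s →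
      X t ω = X (fun i => if i ∈ s then 1 else t i) ω := by
    intro s
    induction s using Finset.induction_on with
    | empty => simp
    | insert j s hjs ih =>
      intro hs
      have hj : j ≠ Fin.last m := fun h => hs (by simp [h])
      have hs' : Fin.last m ∉ s := fun h => hs (by simp [h])
      rw [ih hs', hslab j hj]
      · congr 1
        ext i
        by_cases hi : i = j
        · subst hi; simp
        · simp [hi]
      · intro i
        simp only [Pi.add_apply, slabSides]
        by_cases hi : i = j
        · subst hi
          simpa [hjs] using ht2 i hj
        · by_cases hl : i = Fin.last m
          · subst hl
            simpa [hi, hs'] using ht3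
          · have h2 : t i ≤ 2 := (ht2 i hl).trans (by rw [← one_add_one_eq_two]; gcongr)
            simp only [hi, hl, if_false, Pi.single_eq_of_ne hi, zero_add]
            split_ifs
            · norm_num
            · exact h2
      · simpa [hjs] using ht1 j hj
  rw [key (Finset.univ.erase (Fin.last m)) (by simp)]
  congr 1
  ext i
  by_cases hi : i = Fin.last m
  · subst hi; simp [linePoint_last]
  · simp [hi, linePoint_of_ne]

/-- Off the exceptional set, the sheet is constant on the box of side `s⁻³` above the point
`(1, …, 1, s)`, for each jump time `s` in `(k + 1, k + 2]`. -/
theorem eq_of_isJumpTime_of_notMem_badSet {k : ℕ} {ω : Ω} (hlamp : IsLamp fun t => X t ω)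
    (hω : ω ∉ badSet X k) {s : ℝ≥0} (hs : IsJumpTime (fun t => X (linePoint m t) ω) s)
    (hks : (k : ℝ≥0) + 1 < s) (hsk : s ≤ k + 2) {t : Fin (m + 1) → ℝ≥0}
    (ht1 : linePoint m s ≤ t) (ht2 : ∀ i, t i ≤ linePoint m s i + (s ^ 3)⁻¹) :
    X t ω = X (linePoint m s) ω := by
  have hε : (s ^ 3)⁻¹ ≤ 1 / ((k : ℝ≥0) + 1) ^ 3 := by
    rw [one_div]
    gcongr
  have hε1 : 1 / ((k : ℝ≥0) + 1) ^ 3 ≤ 1 := by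
    rw [div_le_one₀ (by positivity)]
    exact one_le_pow₀ (by simp)
  have hl1 := ht1 (Fin.last m)
  have hl2 := ht2 (Fin.last m)
  rw [linePoint_last] at hl1 hl2
  have hl3 : t (Fin.last m) ≤ s + 1 / ((k : ℝ≥0) + 1) ^ 3 := hl2.trans (by gcongr)
  rw [eq_linePoint_of_notMem_badSet hω]
  · have hsp : ∃ᶠ n in atTop, SparseOnGrid (fun t => X (linePoint m t) ω) (k + 1) n
        (1 / ((k : ℝ≥0) + 1) ^ 3) := by
      by_contra h
      exact hω (Or.inl h)
    refine hlamp.isCadlag.eq_of_isJumpTime hsp hs (by exact_mod_cast hks) ?_ hl1 hl3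
    refine hsk.trans (le_of_eq ?_)
    push_cast
    ring
  · intro i hi
    simpa [linePoint_of_ne _ hi] using ht1 i
  · intro i hi
    have := ht2 i
    rw [linePoint_of_ne _ hi] at this
    exact this.trans (by gcongr)
  · calc t (Fin.last m) ≤ (k + 2) + 1 := hl3.trans (add_le_add hsk hε1)
      _ = k + 3 := by ring

theorem prod_slabSides_le (m k : ℕ) (j : Fin (m + 1)) :
    ∏ i, slabSides m k j i ≤ 2 ^ (m + 1) * 3 / ((k : ℝ≥0) + 1) ^ 2 := by
  have h1 : ∀ i, slabSides m k j i ≤ (if i = j then 1 / ((k : ℝ≥0) + 1) ^ 3 else 1) *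
      (if i = Fin.last m then (k : ℝ≥0) + 3 else 1) * 2 := by
    intro i
    have h2 : (1 : ℝ≥0) ≤ (k + 3) * 2 := by
      calc (1 : ℝ≥0) ≤ (0 + 3) * 2 := by norm_num
        _ ≤ _ := by gcongr; simp
    unfold slabSides
    by_cases hj : i = j <;> by_cases hl : i = Fin.last m
    · rw [if_pos hj, if_pos hj, if_pos hl, mul_assoc]
      exact le_mul_of_one_le_right zero_le h2
    · rw [if_pos hj, if_pos hj, if_neg hl, mul_one]
      exact le_mul_of_one_le_right zero_le (by norm_num)
    · rw [if_neg hj, if_pos hl, if_neg hj, if_pos hl, one_mul]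
      exact le_mul_of_one_le_right zero_le (by norm_num)
    · simp [hj, hl]
  refine (Finset.prod_le_prod' fun i _ => h1 i).trans ?_
  rw [Finset.prod_mul_distrib, Finset.prod_mul_distrib, Finset.prod_ite_eq', Finset.prod_ite_eq']
  simp only [Finset.mem_univ, if_true, Finset.prod_const, Finset.card_univ, Fintype.card_fin]
  have hk : (k : ℝ≥0) + 3 ≤ 3 * (k + 1) := by
    rw [mul_add, mul_one]
    gcongr
    exact le_mul_of_one_le_left zero_le (by norm_num)
  calc 1 / ((k : ℝ≥0) + 1) ^ 3 * (k + 3) * 2 ^ (m + 1)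
      ≤ 1 / ((k : ℝ≥0) + 1) ^ 3 * (3 * (k + 1)) * 2 ^ (m + 1) := by gcongr
    _ = _ := by field_simp

variable [MeasurableSpace Ω] {P : Measure Ω}

/-- With `k` in place of a jump time, the volume `δ (k + 3) 2 ^ (m - 1)` of a slab is of order
`k⁻²`, which is summable. -/
theorem measure_badSet_le (hX : IsLevyField P X) {K : ℝ≥0}
    (hK : HasIncrementBound P X K) (k : ℕ) :
    P (badSet X k) ≤ (((K ^ 2 * 2 + m * (K * (2 ^ (m + 1) * 3))) *
      (1 / ((k : ℝ≥0) + 1) ^ 2) : ℝ≥0) : ℝ≥0∞) := by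
  have hw : ∀ j i, 0 < slabSides m k j i := by
    intro j i
    unfold slabSides
    split_ifs <;> positivity
  unfold badSet
  refine (measure_union_le _ _).trans ?_
  rw [add_mul, ENNReal.coe_add]
  refine add_le_add
    ((measure_eventually_not_sparseOnGrid_le hX hK (k + 1) (by positivity)).trans ?_)
    ((measure_biUnion_finset_le _ _).trans ((Finset.sum_le_sum fun j _ =>
      measure_exists_ne_update_le hX.lamp hK j 1 _ (hw j)).trans ?_))
  · rw [ENNReal.coe_le_coe, mul_assoc]
    gcongr
    · simp
    · norm_num
  · rw [← ENNReal.ofNNReal_finsetSum, ENNReal.coe_le_coe]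
    refine (Finset.sum_le_sum fun j _ => mul_le_mul_right (prod_slabSides_le m k j) K).trans ?_
    rw [Finset.sum_const, Finset.card_erase_of_mem (Finset.mem_univ _), Finset.card_univ,
      Fintype.card_fin, nsmul_eq_mul, Nat.add_sub_cancel]
    refine le_of_eq ?_
    ring

theorem ae_eventually_notMem_badSet (hX : IsLevyField P X) {K : ℝ≥0}
    (hK : HasIncrementBound P X K) :
    ∀ᵐ ω ∂P, ∀ᶠ k in atTop, ω ∉ badSet X k := by
  refine ae_eventually_notMem (ne_top_of_le_ne_top ?_
    (ENNReal.tsum_le_tsum fun k => measure_badSet_le hX hK k))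
  rw [ENNReal.tsum_coe_ne_top_iff_summable]
  refine Summable.mul_left _ ?_
  rw [← NNReal.summable_coe]
  have h := (summable_nat_add_iff 1).2 (Real.summable_one_div_nat_pow.2 (one_lt_two))
  simpa using h

end Sheet

/-! ### The test functions attached to the jump times -/

theorem pairing_boxBump {m : ℕ} {x : (Fin (m + 1) → ℝ≥0) → ℝ} {c : Fin (m + 1) → ℝ≥0} {r y : ℝ}
    (hr : 0 < r) (hx : ∀ t : Fin (m + 1) → ℝ≥0,
      (fun i => (t i : ℝ)) ∈ tsupport (boxBump (fun i => (c i : ℝ)) r) → x t = y) :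
    pairing x (boxBump (fun i => (c i : ℝ)) r) = y := by
  have hmeas : MeasurableSet {t : Fin (m + 1) → ℝ | ∀ i, 0 ≤ t i} := by
    simp only [Set.ofPred_forall]
    exact MeasurableSet.iInter fun i => measurableSet_le measurable_const (measurable_pi_apply i)
  unfold pairing
  have h1 : ∀ t ∈ {t : Fin (m + 1) → ℝ | ∀ i, 0 ≤ t i},
      x (fun i => (t i).toNNReal) * boxBump (fun i => (c i : ℝ)) r t =
      y * boxBump (fun i => (c i : ℝ)) r t := by
    intro t (ht : ∀ i, 0 ≤ t i)
    by_cases h : t ∈ tsupport (boxBump (fun i => (c i : ℝ)) r)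
    · rw [hx]
      simpa [Real.coe_toNNReal _ (ht _)] using h
    · rw [image_eq_zero_of_notMem_tsupport h, mul_zero, mul_zero]
  rw [setIntegral_congr_fun hmeas h1, integral_const_mul,
    setIntegral_eq_integral_of_forall_compl_eq_zero, integral_boxBump _ hr, mul_one]
  intro t ht
  refine image_eq_zero_of_notMem_tsupport fun h => ht fun i => ?_
  exact (c i).2.trans ((tsupport_boxBump_subset _ hr h).1 i)

/-- The test function attached to a jump time `S`: the bump on the box of side `S⁻³` above
`(1, …, 1, S)`. It is zero when `S < 1`, where the box is not small, and when `S = ∞`. -/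
noncomputable def jumpTestFunction (m : ℕ) (S : ℝ≥0∞) : (Fin (m + 1) → ℝ) → ℝ :=
  if 1 ≤ S ∧ S < ∞ then
    boxBump (fun i => (linePoint m S.toNNReal i : ℝ)) ((S.toNNReal : ℝ) ^ 3)
  else fun _ => 0

theorem jumpTestFunction_coe (m : ℕ) {s : ℝ≥0} (hs : 1 ≤ s) : jumpTestFunction m s =
    boxBump (fun i => (linePoint m s i : ℝ)) ((s : ℝ) ^ 3) := by
  unfold jumpTestFunction
  rw [if_pos ⟨by exact_mod_cast hs, ENNReal.coe_lt_top⟩, ENNReal.toNNReal_coe]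

theorem isTestFunction_jumpTestFunction (m : ℕ) (S : ℝ≥0∞) :
    IsTestFunction (jumpTestFunction m S) := by
  unfold jumpTestFunction
  split_ifs with h
  · have h1 : 1 ≤ S.toNNReal := by
      rw [← ENNReal.coe_le_coe, ENNReal.coe_toNNReal h.2.ne]
      simpa using h.1
    have : 0 < S.toNNReal := one_pos.trans_le h1
    exact isTestFunction_boxBump _ (by positivity)
  · exact ⟨contDiff_const, HasCompactSupport.zero⟩

theorem exists_schwartzNorm_jumpTestFunction_le (m p : ℕ) : ∃ C : ℝ≥0, ∀ S : ℝ≥0∞, 1 ≤ S →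
    schwartzNorm p (jumpTestFunction m S) ≤ C * S ^ (3 * (m + 1) + 4 * p) := by
  obtain ⟨C, hC⟩ := exists_schwartzNorm_boxBump_le (m + 1) p
  refine ⟨C, fun S hS => ?_⟩
  rcases eq_or_ne S ∞ with rfl | hS'
  · simp [jumpTestFunction, schwartzNorm_zero]
  · lift S to ℝ≥0 using hS'
    have hS1 : 1 ≤ S := by exact_mod_cast hS
    rw [jumpTestFunction_coe m hS1]
    refine hC _ S hS1 (fun i => NNReal.coe_nonneg _) fun i => ?_
    by_cases hi : i = Fin.last m
    · subst hi; rw [linePoint_last]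
    · rw [linePoint_of_ne _ hi]; exact_mod_cast hS1

end LevyField

theorem lemma3p11 {m : ℕ} {Ω : Type*} [MeasurableSpace Ω] (P : Measure Ω)
    [IsProbabilityMeasure P] (X : (Fin (m + 1) → ℝ≥0) → Ω → ℝ) (ν : Measure ℝ)
    (hfinite : ν {x | 1 ≤ |x|} < ∞) (hpos : 0 < ν {x | 1 ≤ |x|})
    (hX : LevyField.IsLevyField P X)
    (htriplet : LevyField.HasCharacteristicTriplet P X
      (∫ x in {x : ℝ | |x| = 1}, x ∂ν) 0 (ν.restrict {x | 1 ≤ |x|}))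
    (L : ℝ≥0 → Ω → ℝ) (hL : ∀ t ω, L t ω = X (LevyField.linePoint m t) ω)
    (S : ℕ → Ω → ℝ≥0∞) (hS : ∀ n ω, S n ω = LevyField.jumpTime (fun t => L t ω) n) :
    ∃ φ : Ω → ℕ → (Fin (m + 1) → ℝ) → ℝ,
      (∀ ω n, LevyField.IsTestFunction (φ ω n)) ∧
      (∀ p : ℕ, ∃ C : ℝ≥0, ∀ ω n, 1 ≤ S n ω →
        LevyField.schwartzNorm p (φ ω n) ≤ C * S n ω ^ (3 * (m + 1) + 4 * p)) ∧
      ∃ Ω' : Set Ω, MeasurableSet Ω' ∧ P Ω' = 1 ∧ ∀ ω ∈ Ω', ∃ N : ℕ, ∀ n ≥ N,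
        S n ω < ∞ ∧
        (tsupport (φ ω n) ⊆ {t | ∀ i, 0 ≤ t i} ∧
          ∃ c : ℝ, ∀ t : Fin (m + 1) → ℝ≥0,
            (fun i => (t i : ℝ)) ∈ tsupport (φ ω n) → X t ω = c) ∧
        LevyField.pairing (fun t => X t ω) (φ ω n) = L (S n ω).toNNReal ω := by
  open LevyField in
  refine ⟨fun ω n => jumpTestFunction m (S n ω), fun ω n => isTestFunction_jumpTestFunction m _,
    fun p => ?_, ?_⟩
  · obtain ⟨C, hC⟩ := exists_schwartzNorm_jumpTestFunction_le m p
    exact ⟨C, fun ω n h => hC _ h⟩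
  have hchar : ∀ (t : Fin (m + 1) → ℝ≥0) (u : ℝ),
      ∫ ω, Complex.exp (Complex.I * u * X t ω) ∂P =
        Complex.exp (((∏ i, (t i : ℝ) : ℝ) : ℂ) * poissonExponent ν u) := by
    intro t u
    rw [htriplet.2 t u, levyExponent_eq ν hfinite]
  obtain ⟨K, hK⟩ := exists_hasIncrementBound hfinite hX hchar
  have hlt : P {ω | X (linePoint m 1) ω = 0} < 1 := by
    refine measure_eq_zero_lt_one (hX.measurable _) hfinite hpos fun u => ?_
    rw [hchar]
    simp [linePoint]
  have hgood : ∀ᵐ ω ∂P, ∃ N : ℕ, ∀ n ≥ N, S n ω < ∞ ∧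
      (tsupport (jumpTestFunction m (S n ω)) ⊆ {t | ∀ i, 0 ≤ t i} ∧
        ∃ c : ℝ, ∀ t : Fin (m + 1) → ℝ≥0,
          (fun i => (t i : ℝ)) ∈ tsupport (jumpTestFunction m (S n ω)) → X t ω = c) ∧
      pairing (fun t => X t ω) (jumpTestFunction m (S n ω)) = L (S n ω).toNNReal ω := by
    filter_upwards [hX.lamp, ae_exists_sparseOnGrid hX hK, ae_frequently_line_ne hX hlt,
      ae_eventually_notMem_badSet hX hK] with ω hlamp hsparse hne hbad
    obtain ⟨r, hr, hjump, hlim⟩ := exists_jumpTime_eq hlamp hsparse hne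
    have hSr : ∀ n, S n ω = r n := by
      intro n
      rw [hS, ← hr]
      simp only [hL]
    have hk : Tendsto (fun n => ⌈r n⌉₊ - 2) atTop atTop :=
      (tendsto_sub_atTop_nat 2).comp ((tendsto_nat_ceil_atTop).comp hlim)
    obtain ⟨N, hN⟩ := eventually_atTop.1
      ((hk.eventually hbad).and ((hlim.eventually_gt_atTop 1).and (eventually_gt_atTop 0)))
    refine ⟨N, fun n hn => ?_⟩
    obtain ⟨hb, hr1, hn0⟩ := hN n hn
    have hr0 : 0 < r n := one_pos.trans hr1
    have hj : IsJumpTime (fun t => X (linePoint m t) ω) (r n) := by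
      have := hjump (n - 1)
      rwa [Nat.sub_add_cancel hn0] at this
    -- The jump time is in `(k + 1, k + 2]` for `k = ⌈r n⌉₊ - 2`, without truncation as `1 < r n`.
    have hc2 : 2 ≤ ⌈r n⌉₊ := Nat.lt_ceil.2 (by simpa using hr1)
    have hc1 : (((⌈r n⌉₊ - 2 : ℕ) : ℝ≥0)) + 2 = ⌈r n⌉₊ := by
      exact_mod_cast Nat.sub_add_cancel hc2
    have hconst : ∀ t : Fin (m + 1) → ℝ≥0, (fun i => (t i : ℝ)) ∈
        tsupport (boxBump (fun i => (linePoint m (r n) i : ℝ)) ((r n : ℝ) ^ 3)) →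
        X t ω = X (linePoint m (r n)) ω := by
      intro t ht
      have hbox := tsupport_boxBump_subset _ (by positivity) ht
      refine eq_of_isJumpTime_of_notMem_badSet hlamp hb hj ?_ ?_ (fun i => ?_) fun i => ?_
      · have : ⌈r n⌉₊ - 2 + 1 < ⌈r n⌉₊ := by omega
        have := Nat.lt_ceil.1 this
        exact_mod_cast this
      · rw [hc1]
        exact Nat.le_ceil _
      · exact_mod_cast hbox.1 i
      · exact_mod_cast hbox.2 i
    rw [hSr, jumpTestFunction_coe m hr1.le]
    refine ⟨ENNReal.coe_lt_top, ⟨fun t ht i => ?_, _, hconst⟩, ?_⟩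
    · exact (NNReal.coe_nonneg _).trans ((tsupport_boxBump_subset _ (by positivity) ht).1 i)
    · rw [ENNReal.toNNReal_coe, hL]
      exact pairing_boxBump (by positivity) hconst
  obtain ⟨B, hB, hBm, hB0⟩ := exists_measurable_superset_of_null (ae_iff.1 hgood)
  refine ⟨Bᶜ, hBm.compl, (prob_compl_eq_one_iff hBm).2 hB0, fun ω hω => ?_⟩
  by_contra hcon
  exact hω (hB hcon)
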